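/- **Setting.** Trees are finite planted reduced (full) binary rooted trees without planar embedding and with positive edge lengths; $\mathcal R$ denotes Horton pruning (remove the leaves with their parental edges, then merge the edges at every vertex of degree two, adding lengths; $\phi$ is the empty tree), and orders of trees, vertices and branches are Horton–Strahler orders. For probability masses $\{p_K\}_{K\ge1}$, coefficients $T_k\ge 0$ ($k\ge 1$) and rates $\lambda_j>0$ ($j\ge1$), the *hierarchical branching process* $S(t)=(\{T_k\},\{\lambda_j\},\{p_K\})$ starts at time $0$ with one root branch, which has order $K$ with probability $p_K$. Independently of all others, every branch of order $j$ produces side branches of each order $i<j$ at rate $\lambda_jT_{j-i}$, and terminates at rate $\lambda_j$; on termination a branch of order $j\ge2$ splits into two branches of order $j-1$, and a branch of order $1$ disappears. The branching history is a random tree $T[S]$ with edge lengths. $\mathrm{GW}(0,\gamma)$ is the random tree whose shape is the binary Galton–Watson tree in which every vertex is a leaf or splits in two with probability $\frac12$ each, and whose edge lengths are, given the shape, i.i.d. exponential with rate $2\gamma$. **Theorem.** Let $\gamma>0$ and let $S$ be the hierarchical branching process with $$\lambda_j=\gamma 2^{2-j},\qquad p_K=2^{-K},\qquad T_k=2^{k-1}\qquad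 (j,K,k\ge 1).$$ Then: 1. $T[S]$ has the same distribution as the critical binary Galton–Watson tree $\mathrm{GW}(0,\gamma)$, as trees with edge lengths and no planar embedding. 2. The law of $T=T[S]$ is self-similar with scaling exponent $\zeta=2$. That is: (coordination) for all $1\le K\le H$, a uniformly chosen complete subtree of order $K$ of a tree distributed as $T$ given order $H$ has the law of $T$ given order $K$, both in shape and, given the shape, in edge lengths; (prune-invariance) the law of the shape of $\mathcal R(T)$ given $\mathcal R(T)\ne\phi$ is the law of the shape of $T$, and, for every shape $\tau$, the law of the edge lengths of $\mathcal R(T)$ given that $\mathcal R(T)$ has shape $\tau$ is the law of $\zeta$ times the edge lengths of $T$ given that $T$ has shape $\tau$. 3. $S$ is critical: if $x_j(s)$ is the expected number of branches of order $j$ alive at time $s$, then $C(s)=\sum_{j\ge1}x_j(s)=1$ for all $s\ge0$. 4. $S$ is time-invariant: with $\Lambda=\operatorname{diag}(\lambda_1,\lambda_2,\dots)$, with $\mathbb G$ the upper triangular Toeplitz matrix with entries $-1$ on the diagonal, $T_1+2$ on the first superdiagonal and $T_k$ on the $k$-th superdiagonal ($k\ge2$), and with $\pi=\sum_K p_Ke_K$,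 the matrix $\mathbb G\Lambda$ defines a bounded operator on $\ell^1(\mathbb R)$, and $e^{\mathbb G\Lambda s}\pi=\pi$ for all $s\ge0$. 5. $L:=\limsup_{k\to\infty}T_k^{1/k}=2$, and the Horton exponent is $R=4$, where $R=1/w_0$ and $w_0$ is the unique real root in $(0,\frac12]$ of $\hat t(z)=-1+2z+\sum_{k\ge1}z^kT_k$, $|z|<1/L$. -/

import Mathlib

open MeasureTheory ProbabilityTheory
open scoped ENNReal

noncomputable section

namespace RandomTree

/-! ### Embedded trees -/

/-- Nonempty, finite, planted, reduced (full) binary trees embedded in the plane, whose edges carry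
marks in `α`. Every non-root vertex is identified with its parental edge, so that `leaf a` is the
tree consisting of a root, a leaf and an edge marked `a` between them, and `node a l r` is the tree
whose root edge is marked `a` and ends in an internal vertex, at which the planted trees `l` and `r`
are attached. -/
inductive PlaneTree (α : Type) : Type
  | leaf (a : α) : PlaneTree α
  | node (a : α) (l r : PlaneTree α) : PlaneTree α

namespace PlaneTree

variable {α β : Type}

/-- The mark of the root edge. -/
def root : PlaneTree α → α
  | leaf a => a
  | node a _ _ => a

/-- Apply `f` to all edge marks. -/
def map (f : α → β) : PlaneTree α → PlaneTree β
  | leaf a => leaf (f a)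
  | node a l r => node (f a) (l.map f) (r.map f)

/-- Horton-Strahler order: a leaf has order `1`; a vertex whose two offspring have orders `i`, `j`
has order `max i j + δ_{ij}`. -/
def order : PlaneTree α → ℕ
  | leaf _ => 1
  | node _ l r => max l.order r.order + (if l.order = r.order then 1 else 0)

/-- Increase the length of the root edge by `c`. -/
def elongate (c : ℝ) : PlaneTree ℝ → PlaneTree ℝ
  | leaf a => leaf (c + a)
  | node a l r => node (c + a) l r

/-- The result of pruning when the root edge of length `a` ends in an internal vertex, and the two
subtrees attached there have been pruned to `x` and `y` (`none` is the empty tree). If exactly one of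
these is empty, the vertex has degree two and series reduction adds the lengths of its edges. -/
def join (a : ℝ) : Option (PlaneTree ℝ) → Option (PlaneTree ℝ) → PlaneTree ℝ
  | none, none => leaf a
  | some l, none => elongate a l
  | none, some r => elongate a r
  | some l, some r => node a l r

/-- Horton pruning: remove the leaves together with their parental edges, then apply series
reduction. The value `none` is the empty tree. -/
def prune : PlaneTree ℝ → Option (PlaneTree ℝ)
  | leaf _ => none
  | node a l r => some (join a l.prune r.prune)

/-- The complete subtrees of order `K` whose initial vertex is not the first vertex below the
root: a subtree is complete when its root edge is the first edge of a branch, that is when the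
parental vertex has a different order. -/
def properComplete (K : ℕ) : PlaneTree α → Multiset (PlaneTree α)
  | leaf _ => 0
  | node a l r =>
      (if l.order = K ∧ (node a l r).order ≠ K then {l} else 0) +
      (if r.order = K ∧ (node a l r).order ≠ K then {r} else 0) +
      (l.properComplete K + r.properComplete K)

/-- All complete subtrees of order `K`. -/
def complete (K : ℕ) (t : PlaneTree α) : Multiset (PlaneTree α) :=
  (if t.order = K then {t} else 0) + t.properComplete K

/-- Boxes: all trees of one fixed shape with the mark of every edge in a prescribed measurable
set. -/
inductive IsBox [MeasurableSpace α] : Set (PlaneTree α) → Prop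
  | leaf (S : Set α) (hS : MeasurableSet S) : IsBox (PlaneTree.leaf '' S)
  | node (S : Set α) (hS : MeasurableSet S) (A B : Set (PlaneTree α)) (hA : IsBox A)
      (hB : IsBox B) :
      IsBox {t | ∃ a ∈ S, ∃ l ∈ A, ∃ r ∈ B, t = PlaneTree.node a l r}

/-- The σ-algebra of the disjoint union, over the (countably many) shapes, of the product
σ-algebras on the edge marks. -/
instance [MeasurableSpace α] : MeasurableSpace (PlaneTree α) :=
  MeasurableSpace.generateFrom {A | IsBox A}

/-- Two embedded trees differ by exchanging the two offspring of one vertex. -/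
inductive Swap : PlaneTree α → PlaneTree α → Prop
  | swap (a : α) (l r : PlaneTree α) : Swap (node a l r) (node a r l)
  | left (a : α) {l l' : PlaneTree α} (r : PlaneTree α) (h : Swap l l') :
      Swap (node a l r) (node a l' r)
  | right (a : α) (l : PlaneTree α) {r r' : PlaneTree α} (h : Swap r r') :
      Swap (node a l r) (node a l r')

end PlaneTree

/-! ### Trees with no planar embedding -/

/-- Nonempty finite planted reduced binary trees with edge marks in `α` and no planar embedding. It
carries the quotient σ-algebra. -/
def NTree (α : Type) : Type := Quot (PlaneTree.Swap (α := α))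

instance (α : Type) [MeasurableSpace α] : MeasurableSpace (NTree α) :=
  inferInstanceAs (MeasurableSpace (Quot _))

/-- Combinatorial trees (no edge lengths), without the empty tree. -/
abbrev Shape : Type := NTree Unit

/-- Trees with edge lengths, without the empty tree. (All the laws below are concentrated on the
trees with positive edge lengths.) -/
abbrev LTree : Type := NTree ℝ

/-- Forget the planar embedding. -/
def PlaneTree.forget {α : Type} (t : PlaneTree α) : NTree α := Quot.mk _ t

namespace PlaneTree

variable {α β : Type}

theorem Swap.map (f : α → β) {s t : PlaneTree α} (h : Swap s t) : Swap (s.map f) (t.map f) := by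
  induction h with
  | swap a l r => exact .swap _ _ _
  | left a r _ ih => exact .left _ _ ih
  | right a l _ ih => exact .right _ _ ih

theorem Swap.order_eq {s t : PlaneTree α} (h : Swap s t) : s.order = t.order := by
  induction h with
  | swap a l r => simp only [order, max_comm l.order, eq_comm (a := l.order)]
  | left a r _ ih => simp only [order, ih]
  | right a l _ ih => simp only [order, ih]

theorem Swap.elongate (c : ℝ) {s t : PlaneTree ℝ} (h : Swap s t) :
    Swap (s.elongate c) (t.elongate c) := by
  cases h with
  | swap a l r => exact .swap _ _ _
  | left a r h => exact .left _ _ h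
  | right a l h => exact .right _ _ h

theorem forget_join_comm (a : ℝ) (x y : Option (PlaneTree ℝ)) :
    (join a x y).forget = (join a y x).forget := by
  cases x <;> cases y <;> first | rfl | exact Quot.sound (.swap _ _ _)

theorem forget_join_congr (a : ℝ) {x x' : Option (PlaneTree ℝ)} (y : Option (PlaneTree ℝ))
    (h : x.map forget = x'.map forget) : (join a x y).forget = (join a x' y).forget := by
  cases x with
  | none => cases x' with
    | none => rfl
    | some _ => simp at h
  | some l => cases x' with
    | none => simp at h
    | some l' =>
      have h' : Quot.mk Swap l = Quot.mk Swap l' := Option.some.inj h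
      cases y with
      | none => exact congrArg (Quot.map (ra := Swap) (rb := Swap) (PlaneTree.elongate a)
          fun _ _ (e : Swap _ _) => e.elongate a) h'
      | some r => exact congrArg (Quot.map (ra := Swap) (rb := Swap)
          (fun u => PlaneTree.node a u r) fun _ _ e => .left _ _ e) h'

theorem Swap.prune {s t : PlaneTree ℝ} (h : Swap s t) :
    s.prune.map forget = t.prune.map forget := by
  induction h with
  | swap a l r => simp only [PlaneTree.prune, Option.map_some, forget_join_comm a l.prune]
  | left a r _ ih => simp only [PlaneTree.prune, Option.map_some, forget_join_congr a _ ih]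
  | right a l _ ih =>
    simp only [PlaneTree.prune, Option.map_some, forget_join_comm a l.prune,
      forget_join_congr a _ ih]

theorem Swap.properComplete (K : ℕ) {s t : PlaneTree α} (h : Swap s t) :
    (s.properComplete K).map forget = (t.properComplete K).map forget := by
  induction h with
  | swap a l r =>
    have e := (Swap.swap a l r).order_eq
    simp only [PlaneTree.properComplete, e, Multiset.map_add]
    abel
  | @left a l l' r h ih =>
    have e := (Swap.left a r h).order_eq
    have f : l.forget = l'.forget := Quot.sound h
    simp only [PlaneTree.properComplete, e, h.order_eq, Multiset.map_add, ih]
    split_ifs <;> simp [f]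
  | @right a l r r' h ih =>
    have e := (Swap.right a l h).order_eq
    have f : r.forget = r'.forget := Quot.sound h
    simp only [PlaneTree.properComplete, e, h.order_eq, Multiset.map_add, ih]
    split_ifs <;> simp [f]

theorem Swap.complete (K : ℕ) {s t : PlaneTree α} (h : Swap s t) :
    (s.complete K).map forget = (t.complete K).map forget := by
  have f : s.forget = t.forget := Quot.sound h
  simp only [PlaneTree.complete, Multiset.map_add, h.properComplete K, h.order_eq]
  split_ifs <;> simp [f]

end PlaneTree

namespace NTree

variable {α β : Type}

/-- Apply `f` to all edge marks. -/
def map (f : α → β) : NTree α → NTree β := Quot.map (PlaneTree.map f) fun _ _ h => h.map f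

/-- The combinatorial shape. -/
def shape (T : LTree) : Shape := T.map fun _ => ()

/-- Multiply all edge lengths by `c`. -/
def scale (c : ℝ) (T : LTree) : LTree := T.map fun x => c * x

/-- Horton-Strahler order. -/
def order : NTree α → ℕ := Quot.lift PlaneTree.order fun _ _ h => h.order_eq

/-- Horton pruning; `none` is the empty tree. -/
def prune : LTree → Option LTree :=
  Quot.lift (fun t => t.prune.map PlaneTree.forget) fun _ _ h => h.prune

/-- The multiset of the complete subtrees of order `K`. -/
def complete (K : ℕ) : NTree α → Multiset (NTree α) :=
  Quot.lift (fun t => (t.complete K).map PlaneTree.forget) fun _ _ h => h.complete K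

open Classical in
/-- The probability that a complete subtree of order `K` of `T`, selected uniformly at random,
belongs to `A`. -/
def completeFraction (K : ℕ) (A : Set (NTree α)) (T : NTree α) : ℝ≥0∞ :=
  ((T.complete K).countP (· ∈ A) : ℝ≥0∞) / ((T.complete K).card : ℝ≥0∞)

end NTree

/-! ### Self-similarity -/

/-- The law of the uniform random complete subtree of order `K` of a random tree that has the law
`η` conditioned on order `H`, evaluated at the event `A`. -/
def subtreeLaw (η : Measure LTree) (K H : ℕ) (A : Set LTree) : ℝ≥0∞ :=
  ∫⁻ T, T.completeFraction K A ∂(cond η {T | T.order = H})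

/-- Self-similarity, with scaling exponent `ζ`, of a distribution on the trees with edge lengths.
A family of edge lengths is the same thing as the pair formed by the relative edge lengths and the
total tree length; accordingly, the two conditions on edge lengths compare the conditional laws of
all edge lengths given the shape `τ`, that is the conditional law of the relative edge lengths given
`τ` together with the conditional law of the total length given `τ` and the relative lengths. -/
structure IsSelfSimilar (η : Measure LTree) (ζ : ℝ) : Prop where
  isProbabilityMeasure : IsProbabilityMeasure η
  exponent_pos : 0 < ζ
  /-- The measure is coordinated in shapes. -/
  coordinated_shape : ∀ K H : ℕ, 1 ≤ K → K ≤ H → ∀ τ : Shape, τ.order = K →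
    subtreeLaw η K H {T | T.shape = τ} = cond η {T | T.order = K} {T | T.shape = τ}
  /-- The measure is coordinated in lengths. -/
  coordinated_length : ∀ K H : ℕ, 1 ≤ K → K ≤ H → ∀ τ : Shape, τ.order = K →
    ∀ A : Set LTree, MeasurableSet A →
      subtreeLaw η K H ({T | T.shape = τ} ∩ A) / subtreeLaw η K H {T | T.shape = τ} =
        cond η {T | T.shape = τ} A
  /-- The measure is prune-invariant in shapes. -/
  prune_shape : ∀ τ : Shape,
    cond η {T | T.prune ≠ none} {T | ∃ T' ∈ T.prune, T'.shape = τ} = η {T | T.shape = τ}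
  /-- The measure is prune-invariant in lengths: given that its shape is `τ`, the pruned tree is
  distributed as the original tree, given that its shape is `τ`, with all lengths multiplied
  by `ζ`. -/
  prune_length : ∀ τ : Shape, ∀ A : Set LTree, MeasurableSet A →
    cond η {T | ∃ T' ∈ T.prune, T'.shape = τ} {T | ∃ T' ∈ T.prune, T' ∈ A} =
      cond η {T | T.shape = τ} {T | T.scale ζ ∈ A}

/-! ### Exponential binary Galton-Watson trees -/

/-- The probability of a given embedded shape under the binary Galton-Watson distribution: each
vertex independently becomes a leaf with probability `p₀` or splits in two with probability `p₂`. -/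
def gwShapeProb (p₀ p₂ : ℝ) : PlaneTree Unit → ℝ
  | .leaf _ => p₀
  | .node _ l r => p₂ * gwShapeProb p₀ p₂ l * gwShapeProb p₀ p₂ r

/-- The law of the tree of a given embedded shape with i.i.d. edge lengths of law `ν`. -/
def iidLengths (ν : Measure ℝ) : PlaneTree Unit → Measure (PlaneTree ℝ)
  | .leaf _ => ν.map PlaneTree.leaf
  | .node _ l r => (ν.prod ((iidLengths ν l).prod (iidLengths ν r))).map
      fun x => PlaneTree.node x.1 x.2.1 x.2.2

/-- The law of the exponential binary Galton-Watson tree `GW(lam', lam)`: the shape is a binary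
Galton-Watson tree with `p₀ = (lam + lam') / (2 lam)` and `p₂ = (lam - lam') / (2 lam)`, and, given
the shape, the edge lengths are independent exponential random variables with rate `2 lam`. -/
def expGW (lam' lam : ℝ) : Measure (PlaneTree ℝ) :=
  Measure.sum fun s : PlaneTree Unit =>
    ENNReal.ofReal (gwShapeProb ((lam + lam') / (2 * lam)) ((lam - lam') / (2 * lam)) s) •
      iidLengths (expMeasure (2 * lam)) s

/-! ### The hierarchical branching process -/

/-- The parameters `({T_k}, {λ_j}, {p_K})`, `k, j, K ≥ 1`, of a hierarchical branching process. The
values of the three sequences at the index `0` play no role. -/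
structure HBP where
  /-- The Tokunaga coefficients. -/
  T : ℕ → ℝ
  /-- The termination rates. -/
  lam : ℕ → ℝ
  /-- The distribution of the order of the root branch. -/
  p : ℕ → ℝ
  T_nonneg : ∀ k, 1 ≤ k → 0 ≤ T k
  lam_pos : ∀ j, 1 ≤ j → 0 < lam j
  p_nonneg : ∀ K, 1 ≤ K → 0 ≤ p K
  p_sum : HasSum (fun n => p (n + 1)) 1

namespace HBP

variable (S : HBP)

/-- The rate of the different transitions of a branch of order `j`. `none`: the branch disappears
without offspring. `some (a, b)`: it is replaced by branches of orders `a` and `b`, which is either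
the production of a side branch of order `b < j` (and then `a = j` is the branch itself, which
continues), or the termination of a branch of order `j ≥ 2`, which splits into two branches of
order `j - 1`. -/
def rate (j : ℕ) : Option (ℕ × ℕ) → ℝ
  | none => if j = 1 then S.lam j else 0
  | some (a, b) =>
      if a = j ∧ 1 ≤ b ∧ b < j then S.lam j * S.T (j - b)
      else if 2 ≤ j ∧ a = j - 1 ∧ b = j - 1 then S.lam j
      else 0

/-- The total rate of the transitions of a branch of order `j`: termination, and the production of
side branches of the orders `1 ≤ i < j`. -/
def totalRate (j : ℕ) : ℝ := S.lam j + ∑ i ∈ Finset.Ico 1 j, S.lam j * S.T (j - i)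

/-- The branching history of a branch of order `s.root`, restricted to the event that the embedded
genealogical tree, with the orders of its edges, is `s`. Every edge of order `j` lasts an exponential
time with rate `totalRate j`; then a transition takes place, chosen with probability proportional to
its rate, independently of that time; the two resulting branches evolve independently. The edges of
the resulting tree are marked by order and length. -/
def historyLaw : PlaneTree ℕ → Measure (PlaneTree (ℕ × ℝ))
  | .leaf j => ENNReal.ofReal (S.rate j none / S.totalRate j) •
      (expMeasure (S.totalRate j)).map fun x => PlaneTree.leaf (j, x)
  | .node j l r => ENNReal.ofReal (S.rate j (some (l.root, r.root)) / S.totalRate j) •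
      ((expMeasure (S.totalRate j)).prod ((historyLaw l).prod (historyLaw r))).map
        fun x => PlaneTree.node (j, x.1) x.2.1 x.2.2

/-- The law of the hierarchical branching process `S(t)`, through its complete branching history:
the root branch has order `K` with probability `p_K`. -/
def processLaw : Measure (PlaneTree (ℕ × ℝ)) :=
  Measure.sum fun s : PlaneTree ℕ => ENNReal.ofReal (S.p s.root) • S.historyLaw s

/-- The law of the tree `T[S]`: binary, with edge lengths and no planar embedding. -/
def treeLaw : Measure LTree := S.processLaw.map fun t => (t.map Prod.snd).forget

/-- The number of branches of order `j` that are alive at time `s`, when the root branch is born at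
time `0`. -/
def alive (j : ℕ) : ℝ → PlaneTree (ℕ × ℝ) → ℕ
  | s, .leaf a => if a.1 = j ∧ 0 ≤ s ∧ s < a.2 then 1 else 0
  | s, .node a l r => (if a.1 = j ∧ 0 ≤ s ∧ s < a.2 then 1 else 0) +
      alive j (s - a.2) l + alive j (s - a.2) r

/-- The average number `x_j(s)` of branches of order `j` at time `s`. -/
def average (j : ℕ) (s : ℝ) : ℝ≥0∞ := ∫⁻ t, (alive j s t : ℝ≥0∞) ∂S.processLaw

/-- The width function `C(s) = ∑_{j ≥ 1} x_j(s)`. -/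
def width (s : ℝ) : ℝ≥0∞ := ∑' n : ℕ, S.average (n + 1) s

/-- The process is critical: the width function is constantly one. -/
def IsCritical : Prop := ∀ s : ℝ, 0 ≤ s → S.width s = 1

/-- The space `ℓ¹(ℝ)`; the coordinate `n` belongs to the order `n + 1`. -/
abbrev SeqL1 : Type := lp (fun _ : ℕ => ℝ) 1

/-- The vector `π = ∑_K p_K e_K`. -/
def initial : SeqL1 :=
  ⟨fun n => S.p (n + 1), by
    refine memℓp_gen ?_
    simpa [abs_of_nonneg (S.p_nonneg (_ + 1) (Nat.le_add_left 1 _))] using S.p_sum.summable⟩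

/-- The entries of the infinite upper triangular Toeplitz matrix `𝔾`: `-1` on the diagonal,
`T_1 + 2` on the first superdiagonal, and `T_k` on the `k`-th superdiagonal for `k ≥ 2`. -/
def G (i j : ℕ) : ℝ :=
  if j = i then -1 else if j = i + 1 then S.T 1 + 2 else if i < j then S.T (j - i) else 0

/-- The process is time-invariant: `𝔾Λ`, where `Λ = diag(λ_1, λ_2, …)`, acts on `ℓ¹` as a bounded
operator `M`, and `exp(s𝔾Λ) π = π` for all `s ≥ 0`. -/
def IsTimeInvariant : Prop :=
  ∃ M : SeqL1 →L[ℝ] SeqL1,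
    (∀ (x : SeqL1) (i : ℕ), HasSum (fun j => S.G i j * S.lam (j + 1) * x j) (M x i)) ∧
    ∀ s : ℝ, 0 ≤ s → (NormedSpace.exp (s • M)) S.initial = S.initial

/-- `L = limsup_k T_k^{1/k}`. -/
def L : ℝ≥0∞ := Filter.limsup (fun k : ℕ => ENNReal.ofReal (S.T k) ^ (1 / (k : ℝ))) Filter.atTop

/-- `w ∈ (0, 1/2]`, `w < 1/L`, is a root of `t̂(z) = -1 + 2 z + ∑_{k ≥ 1} z^k T_k`. -/
def IsRoot (w : ℝ) : Prop :=
  0 < w ∧ w ≤ 1 / 2 ∧ ENNReal.ofReal w < 1 / S.L ∧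
    HasSum (fun n : ℕ => w ^ (n + 1) * S.T (n + 1)) (1 - 2 * w)

/-- `R` is the Horton exponent: `R = 1 / w₀` for the unique root `w₀` of `t̂` in `(0, 1/2]`. -/
def IsHortonExponent (R : ℝ) : Prop := ∃ w : ℝ, S.IsRoot w ∧ (∀ v, S.IsRoot v → v = w) ∧ R = 1 / w

end HBP

end RandomTree

end

/-! The first three parts are properties of the critical Galton–Watson tree. With these parameters
every branch, whatever its order, has total transition rate λ_j(1 + T_1 + … + T_{j-1}) = λ_j 2^{j-1}
= 2γ, so given the genealogy the edges of the history are i.i.d. exponential, as in GW(0, γ). It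
remains to match the discrete choices. A Galton–Watson tree is sorted so that the subtree of larger
order comes first; this is how the process lists offspring, and it changes only the embedding. The
balance ½·(1 if i = k, 2 if i > k)·p_i p_k = p_j·(rate of j → i, k)/(2γ), proved in
`weight_balance`, lets an induction on the sorted tree identify both laws (`lintegral_historyLaw`,
`processLaw_eq`).

Prune-invariance: decomposed at the first vertex, the pruned tree given that it is not empty solves
a distributional equation (`pruneStep`). The tree GW with exp(γ) edges solves the same equation,
because exp(γ) is a geometric sum of exp(2γ) variables. The solution is unique
(`eq_of_eq_pruneStep`), and exp(γ) is exp(2γ) scaled by 2, whence ζ = 2.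

Coordination: what lies outside a complete subtree of order K is independent of it and sees it only
through its order K. Hence a complete subtree chosen with a weight depending only on the order of
the whole tree and on the number of such subtrees has the law of the tree given order K
(`lintegral_countP_complete`); uniform choice given order H is such a weight.

Criticality: the mean number of edges of generation n alive at time s is the Poisson probability of
n with mean 2γs (`lintegral_edgeLevel`), and these sum to 1. Time invariance holds because 𝔾Λπ = 0,
and the Horton exponent comes from summing a geometric series. -/

noncomputable section

namespace RandomTree

namespace PlaneTree

/-! ### Countability and elementary structure of embedded trees -/

section Countable

variable {α : Type}

/-- An encoding of the marked trees by natural numbers, given an encoding of the marks. -/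
def code (e : α → ℕ) : PlaneTree α → ℕ
  | leaf a => 2 * e a
  | node a l r => 2 * Nat.pair (e a) (Nat.pair (code e l) (code e r)) + 1

theorem code_injective {e : α → ℕ} (he : Function.Injective e) :
    Function.Injective (code e) := by
  intro s
  induction s with
  | leaf a =>
    intro t h
    cases t with
    | leaf b =>
      simp only [code] at h
      rw [he (by omega : e a = e b)]
    | node b l r => simp only [code] at h; omega
  | node a l r ihl ihr =>
    intro t h
    cases t with
    | leaf b => simp only [code] at h; omega
    | node b l' r' =>
      simp only [code] at h
      have h1 : Nat.pair (e a) (Nat.pair (code e l) (code e r)) =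
        Nat.pair (e b) (Nat.pair (code e l') (code e r')) := by omega
      rw [Nat.pair_eq_pair, Nat.pair_eq_pair] at h1
      rw [he h1.1, ihl h1.2.1, ihr h1.2.2]

instance [Countable α] : Countable (PlaneTree α) := by
  obtain ⟨e, he⟩ := exists_injective_nat α
  exact (code_injective he).countable

end Countable

variable {α β : Type}

/-- The tree is a single edge. -/
def IsLeaf : PlaneTree α → Prop
  | leaf _ => True
  | node _ _ _ => False

instance (t : PlaneTree α) : Decidable t.IsLeaf :=
  match t with
  | leaf _ => .isTrue trivial
  | node _ _ _ => .isFalse id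

@[simp] theorem isLeaf_leaf (a : α) : (leaf a).IsLeaf := trivial
@[simp] theorem not_isLeaf_node (a : α) (l r : PlaneTree α) : ¬ (node a l r).IsLeaf := id

/-- The left subtree below the root edge; the tree itself if there is none. -/
def lft : PlaneTree α → PlaneTree α
  | leaf a => leaf a
  | node _ l _ => l

/-- The right subtree below the root edge; the tree itself if there is none. -/
def rgt : PlaneTree α → PlaneTree α
  | leaf a => leaf a
  | node _ _ r => r

/-- The constructor `node` on triples. -/
def mk3 (x : α × PlaneTree α × PlaneTree α) : PlaneTree α := node x.1 x.2.1 x.2.2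

theorem mk3_injective : Function.Injective (mk3 (α := α)) := by
  rintro ⟨a, l, r⟩ ⟨a', l', r'⟩ h
  simpa [mk3] using h

theorem map_map {γ : Type} (f : α → β) (g : β → γ) (t : PlaneTree α) :
    (t.map f).map g = t.map (g ∘ f) := by
  induction t <;> simp_all [map]

theorem order_map (f : α → β) (t : PlaneTree α) : (t.map f).order = t.order := by
  induction t <;> simp_all [map, order]

theorem one_le_order (t : PlaneTree α) : 1 ≤ t.order := by
  induction t with
  | leaf a => exact le_rfl
  | node a l r ihl ihr => simp only [order]; omega

theorem image_mk3_prod (S : Set α) (A B : Set (PlaneTree α)) :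
    mk3 '' (S ×ˢ (A ×ˢ B)) = {t | ∃ a ∈ S, ∃ l ∈ A, ∃ r ∈ B, t = node a l r} := by
  ext t
  constructor
  · rintro ⟨⟨a, l, r⟩, ⟨ha, hl, hr⟩, rfl⟩
    exact ⟨a, ha, l, hl, r, hr, rfl⟩
  · rintro ⟨a, ha, l, hl, r, hr, rfl⟩
    exact ⟨⟨a, l, r⟩, ⟨ha, hl, hr⟩, rfl⟩

theorem eq_image_union (A : Set (PlaneTree α)) :
    A = leaf '' (leaf ⁻¹' A) ∪ mk3 '' (mk3 ⁻¹' A) := by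
  ext t
  cases t with
  | leaf a => simp [mk3]
  | node a l r => simp [mk3]

/-! ### The σ-algebra on marked trees -/

variable [MeasurableSpace α] [MeasurableSpace β]

theorem IsBox.measurableSet {A : Set (PlaneTree α)} (h : IsBox A) : MeasurableSet A :=
  MeasurableSpace.measurableSet_generateFrom h

theorem isBox_fibre (s : PlaneTree Unit) :
    IsBox {t : PlaneTree α | t.map (fun _ => ()) = s} := by
  induction s with
  | leaf a =>
    convert IsBox.leaf Set.univ MeasurableSet.univ using 1
    ext t
    cases t <;> simp [map]
  | node a l r ihl ihr =>
    convert IsBox.node Set.univ MeasurableSet.univ _ _ ihl ihr using 1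
    ext t
    cases t <;> simp [map]

/-- There are countably many shapes, and the trees of one shape form a box. `generateFrom_eq_prod`
needs this in order to generate the product σ-algebra by products of boxes. -/
theorem isCountablySpanning_isBox : IsCountablySpanning {A : Set (PlaneTree α) | IsBox A} := by
  have : Nonempty (PlaneTree Unit) := ⟨leaf ()⟩
  obtain ⟨e, he⟩ := exists_surjective_nat (PlaneTree Unit)
  refine ⟨fun n => {t | t.map (fun _ => ()) = e n}, fun n => isBox_fibre _, ?_⟩
  refine Set.eq_univ_of_forall fun t => ?_
  obtain ⟨n, hn⟩ := he (t.map fun _ => ())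
  exact Set.mem_iUnion.2 ⟨n, hn.symm⟩

theorem measurable_leaf : Measurable (leaf : α → PlaneTree α) := by
  refine measurable_generateFrom fun A hA => ?_
  cases hA with
  | leaf S hS => rwa [Set.preimage_image_eq _ fun a b h => by simpa using h]
  | node S hS A B hA hB =>
    convert MeasurableSet.empty
    ext; simp

theorem measurable_mk3 : Measurable (mk3 : α × PlaneTree α × PlaneTree α → PlaneTree α) := by
  refine measurable_generateFrom fun A hA => ?_
  cases hA with
  | leaf S hS =>
    convert MeasurableSet.empty
    ext; simp [mk3]
  | node S hS A B hA hB =>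
    rw [← image_mk3_prod, Set.preimage_image_eq _ mk3_injective]
    exact hS.prod (hA.measurableSet.prod hB.measurableSet)

theorem measurableSet_image_leaf {S : Set α} (hS : MeasurableSet S) :
    MeasurableSet (leaf '' S) := (IsBox.leaf S hS).measurableSet

theorem measurableSet_isLeaf : MeasurableSet {t : PlaneTree α | t.IsLeaf} := by
  convert measurableSet_image_leaf (α := α) MeasurableSet.univ
  ext t
  cases t <;> simp

/-- The σ-algebra on triples is generated by products of a measurable set and two boxes, and the
image of such a product is a box by definition. So `mk3` is a measurable embedding, and
measurability can be tested on leaves and nodes separately. -/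
theorem measurableSet_image_mk3 {C : Set (α × PlaneTree α × PlaneTree α)}
    (hC : MeasurableSet C) : MeasurableSet (mk3 '' C) := by
  have h1 := generateFrom_eq_prod (α := PlaneTree α) (β := PlaneTree α) rfl rfl
    isCountablySpanning_isBox isCountablySpanning_isBox
  have h2 := generateFrom_eq_prod (α := α) (β := PlaneTree α × PlaneTree α)
    MeasurableSpace.generateFrom_measurableSet h1 isCountablySpanning_measurableSet
    (isCountablySpanning_isBox.prod isCountablySpanning_isBox)
  rw [← h2] at hC
  induction C, hC using MeasurableSpace.generateFrom_induction with
  | hC t ht _ =>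
    obtain ⟨S, hS, _, ⟨A, hA, B, hB, rfl⟩, rfl⟩ := ht
    rw [image_mk3_prod]
    exact (IsBox.node S hS A B hA hB).measurableSet
  | empty => simp
  | compl t _ ih =>
    have : mk3 '' tᶜ = {t : PlaneTree α | t.IsLeaf}ᶜ \ mk3 '' t := by
      ext u
      cases u <;> simp [mk3]
    rw [this]
    exact measurableSet_isLeaf.compl.diff ih
  | iUnion s _ ih =>
    rw [Set.image_iUnion]
    exact MeasurableSet.iUnion ih

/-- Measurability by cases on the root vertex. -/
theorem measurable_of_cases {f : PlaneTree α → β} (h1 : Measurable fun a => f (leaf a))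
    (h2 : Measurable fun x : α × PlaneTree α × PlaneTree α => f (mk3 x)) : Measurable f := by
  intro B hB
  rw [eq_image_union (f ⁻¹' B)]
  exact (measurableSet_image_leaf (h1 hB)).union (measurableSet_image_mk3 (h2 hB))

theorem measurable_root : Measurable (root : PlaneTree α → α) :=
  measurable_of_cases measurable_id measurable_fst

theorem measurable_lft : Measurable (lft : PlaneTree α → PlaneTree α) :=
  measurable_of_cases measurable_leaf (measurable_fst.comp measurable_snd)

theorem measurable_rgt : Measurable (rgt : PlaneTree α → PlaneTree α) :=
  measurable_of_cases measurable_leaf (measurable_snd.comp measurable_snd)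

theorem _root_.Measurable.leaf {f : β → α} (hf : Measurable f) :
    Measurable fun x => PlaneTree.leaf (f x) := measurable_leaf.comp hf

theorem _root_.Measurable.node {f : β → α} {g h : β → PlaneTree α} (hf : Measurable f)
    (hg : Measurable g) (hh : Measurable h) :
    Measurable fun x => PlaneTree.node (f x) (g x) (h x) :=
  measurable_mk3.comp (hf.prodMk (hg.prodMk hh))

/-- Measurability of a function defined by structural recursion. -/
theorem measurable_of_rec {f : PlaneTree α → β} (g₀ : α → β)
    (g : α → PlaneTree α → PlaneTree α → β → β → β) (hg₀ : Measurable g₀)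
    (hg : Measurable fun x : α × PlaneTree α × PlaneTree α × β × β =>
      g x.1 x.2.1 x.2.2.1 x.2.2.2.1 x.2.2.2.2)
    (h₀ : ∀ a, f (leaf a) = g₀ a) (h : ∀ a l r, f (node a l r) = g a l r (f l) (f r)) :
    Measurable f := by
  -- `F n` unfolds the recursion `n` times and treats what remains as a leaf. It is measurable by
  -- induction on `n`, and on each tree it agrees with `f` for all large `n`.
  let F : ℕ → PlaneTree α → β := fun n => n.rec (fun t => g₀ t.root)
    fun _ G t => if t.IsLeaf then g₀ t.root else g t.root t.lft t.rgt (G t.lft) (G t.rgt)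
  have hF : ∀ n, Measurable (F n) := by
    intro n
    induction n with
    | zero => exact hg₀.comp measurable_root
    | succ n ih =>
      exact Measurable.ite measurableSet_isLeaf (hg₀.comp measurable_root)
        (hg.comp (measurable_root.prodMk (measurable_lft.prodMk (measurable_rgt.prodMk
          ((ih.comp measurable_lft).prodMk (ih.comp measurable_rgt))))))
  have hE : ∀ t, ∃ N, ∀ n, N ≤ n → F n t = f t := by
    intro t
    induction t with
    | leaf a =>
      refine ⟨0, fun n _ => ?_⟩
      cases n with
      | zero => exact (h₀ a).symm
      | succ n => simp [F, h₀, root]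
    | node a l r ihl ihr =>
      obtain ⟨N, hN⟩ := ihl
      obtain ⟨M, hM⟩ := ihr
      refine ⟨max N M + 1, fun n hn => ?_⟩
      obtain ⟨n, rfl⟩ : ∃ m, n = m + 1 := ⟨n - 1, by omega⟩
      have e1 := hN n (by omega)
      have e2 := hM n (by omega)
      rw [h, ← e1, ← e2]
      rfl
  intro B hB
  -- The approximations are eventually constant on each tree, so the preimage is a liminf of
  -- preimages and no topology on `β` is needed.
  have : f ⁻¹' B = ⋃ N : ℕ, ⋂ n : ℕ, F (N + n) ⁻¹' B := by
    ext t
    obtain ⟨N, hN⟩ := hE t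
    simp only [Set.mem_preimage, Set.mem_iUnion, Set.mem_iInter]
    constructor
    · intro ht
      exact ⟨N, fun n => by rwa [hN _ (by omega)]⟩
    · rintro ⟨M, hM⟩
      have := hM N
      rwa [hN _ (by omega)] at this
  rw [this]
  exact MeasurableSet.iUnion fun N => MeasurableSet.iInter fun n => hF _ hB

theorem measurable_map {f : α → β} (hf : Measurable f) : Measurable (map f) :=
  measurable_of_rec (fun a => leaf (f a)) (fun a _ _ l r => node (f a) l r) hf.leaf
    (Measurable.node (by fun_prop) (by fun_prop) (by fun_prop)) (fun _ => rfl)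
    (fun _ _ _ => rfl)

theorem measurable_order : Measurable (order : PlaneTree α → ℕ) := by
  have h : Measurable fun p : ℕ × ℕ => max p.1 p.2 + (if p.1 = p.2 then 1 else 0) :=
    measurable_of_countable _
  refine measurable_of_rec (fun _ => 1) (fun _ _ _ i j => max i j + (if i = j then 1 else 0))
    measurable_const ?_ (fun _ => rfl) (fun _ _ _ => rfl)
  exact h.comp (by fun_prop : Measurable fun x : α × PlaneTree α × PlaneTree α × ℕ × ℕ =>
    (x.2.2.2.1, x.2.2.2.2))

theorem measurable_forget : Measurable (forget : PlaneTree α → NTree α) := fun _ h => h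

theorem measurableSet_ntree {A : Set (NTree α)} :
    MeasurableSet A ↔ MeasurableSet (forget ⁻¹' A) := Iff.rfl

/-- Singletons of trees are measurable when singletons of marks are. -/
instance [MeasurableSingletonClass α] : MeasurableSingletonClass (PlaneTree α) where
  measurableSet_singleton s := by
    refine IsBox.measurableSet ?_
    induction s with
    | leaf a => simpa using IsBox.leaf {a} (measurableSet_singleton a)
    | node a l r ihl ihr => simpa using IsBox.node {a} (measurableSet_singleton a) _ _ ihl ihr

end PlaneTree

/-! ### The critical binary Galton–Watson law -/

open PlaneTree

/-- The probability of an embedded shape under the critical binary Galton-Watson law. -/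
def shapeWeight (s : PlaneTree Unit) : ℝ≥0∞ := ENNReal.ofReal (gwShapeProb (1 / 2) (1 / 2) s)

theorem gwShapeProb_half_nonneg (s : PlaneTree Unit) : 0 ≤ gwShapeProb (1 / 2) (1 / 2) s := by
  induction s with
  | leaf a => norm_num [gwShapeProb]
  | node a l r ihl ihr => simp only [gwShapeProb]; positivity

theorem ofReal_half : ENNReal.ofReal (1 / 2) = 2⁻¹ := by
  rw [one_div, ENNReal.ofReal_inv_of_pos two_pos, ENNReal.ofReal_ofNat]

theorem shapeWeight_leaf (a : Unit) : shapeWeight (leaf a) = 2⁻¹ := ofReal_half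

theorem shapeWeight_node (a : Unit) (l r : PlaneTree Unit) :
    shapeWeight (node a l r) = 2⁻¹ * (shapeWeight l * shapeWeight r) := by
  have h := gwShapeProb_half_nonneg l
  simp only [shapeWeight, gwShapeProb]
  rw [ENNReal.ofReal_mul (by positivity), ENNReal.ofReal_mul (by positivity), ofReal_half,
    mul_assoc]

/-- A shape is a leaf or a pair of shapes. -/
def shapeEquiv : Unit ⊕ PlaneTree Unit × PlaneTree Unit ≃ PlaneTree Unit where
  toFun := Sum.elim (fun _ => leaf ()) fun p => node () p.1 p.2
  invFun
    | leaf _ => .inl ()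
    | node _ l r => .inr (l, r)
  left_inv x := by cases x <;> rfl
  right_inv t := by cases t <;> rfl

theorem tsum_shape (f : PlaneTree Unit → ℝ≥0∞) :
    ∑' s, f s = f (leaf ()) + ∑' p : PlaneTree Unit × PlaneTree Unit, f (node () p.1 p.2) := by
  rw [← shapeEquiv.tsum_eq, Summable.tsum_sum ENNReal.summable ENNReal.summable]
  simp [shapeEquiv]

/-- The number of generations of a tree. -/
def depth {α : Type} : PlaneTree α → ℕ
  | leaf _ => 1
  | node _ l r => max (depth l) (depth r) + 1

/-- If m_n is the mass of the shapes with at most n generations, then m_{n+1} = 1/2 + m_n²/2, which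
preserves m_n ≤ 1. -/
theorem tsum_shapeWeight_depth_le (n : ℕ) :
    ∑' s, (if depth s ≤ n then shapeWeight s else 0) ≤ 1 := by
  induction n with
  | zero =>
    have : ∀ s : PlaneTree Unit, ¬ depth s ≤ 0 := by
      intro s; cases s <;> simp [depth]
    simp [this]
  | succ n ih =>
    rw [tsum_shape]
    have : ∀ p : PlaneTree Unit × PlaneTree Unit,
        (if depth (node () p.1 p.2) ≤ n + 1 then shapeWeight (node () p.1 p.2) else 0) =
        2⁻¹ * ((if depth p.1 ≤ n then shapeWeight p.1 else 0) *
          (if depth p.2 ≤ n then shapeWeight p.2 else 0)) := by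
      intro p
      simp only [depth, Nat.add_le_add_iff_right, max_le_iff, shapeWeight_node]
      split_ifs <;> simp_all
    simp_rw [this]
    rw [ENNReal.tsum_mul_left, ENNReal.tsum_prod (f := fun l r =>
      (if depth l ≤ n then shapeWeight l else 0) * (if depth r ≤ n then shapeWeight r else 0))]
    simp_rw [ENNReal.tsum_mul_left, ENNReal.tsum_mul_right]
    calc _ ≤ (2⁻¹ : ℝ≥0∞) + 2⁻¹ * (1 * 1) := by
          gcongr
          simp [depth, shapeWeight_leaf]
      _ = 1 := by rw [mul_one, mul_one, ENNReal.inv_two_add_inv_two]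

/-- The total mass solves Z = 1/2 + Z²/2, that is (Z − 1)² = 0. The a priori bound Z ≤ 1 is needed
to exclude the other solution Z = ⊤. -/
theorem tsum_shapeWeight : ∑' s, shapeWeight s = 1 := by
  have hle : ∑' s, shapeWeight s ≤ 1 := by
    rw [ENNReal.tsum_eq_iSup_sum]
    refine iSup_le fun F => ?_
    -- A finite set of shapes has bounded depth.
    refine le_trans ?_ (tsum_shapeWeight_depth_le (F.sup depth))
    refine le_trans (Finset.sum_le_sum fun s hs => ?_) (ENNReal.sum_le_tsum F)
    rw [if_pos (Finset.le_sup (f := depth) hs)]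
  set Z := ∑' s, shapeWeight s with hZ
  have hfix : Z = 2⁻¹ + 2⁻¹ * (Z * Z) := by
    conv_lhs => rw [hZ, tsum_shape]
    simp_rw [shapeWeight_node, shapeWeight_leaf]
    rw [ENNReal.tsum_mul_left, ENNReal.tsum_prod (f := fun l r => shapeWeight l * shapeWeight r)]
    simp_rw [ENNReal.tsum_mul_left, ENNReal.tsum_mul_right]
    rfl
  have htop : Z ≠ ⊤ := ne_top_of_le_ne_top ENNReal.one_ne_top hle
  clear_value Z
  lift Z to NNReal using htop
  have h2 : (2⁻¹ : ℝ≥0∞) = ((2⁻¹ : NNReal) : ℝ≥0∞) := by simp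
  rw [h2] at hfix
  norm_cast at hfix ⊢
  have h3 : (Z : ℝ) = 2⁻¹ + 2⁻¹ * (Z * Z) := by
    simpa using congrArg NNReal.toReal hfix
  have h4 : (Z : ℝ) = 1 := by nlinarith [sq_nonneg ((Z : ℝ) - 1)]
  exact_mod_cast h4

instance isProbabilityMeasure_iidLengths (ν : Measure ℝ) [IsProbabilityMeasure ν]
    (s : PlaneTree Unit) : IsProbabilityMeasure (iidLengths ν s) := by
  induction s with
  | leaf a => exact Measure.isProbabilityMeasure_map measurable_leaf.aemeasurable
  | node a l r ihl ihr => exact Measure.isProbabilityMeasure_map measurable_mk3.aemeasurable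

/-- The law of the critical binary Galton-Watson tree with i.i.d. edge lengths of law `ν`. -/
def gw (ν : Measure ℝ) : Measure (PlaneTree ℝ) :=
  Measure.sum fun s => shapeWeight s • iidLengths ν s

theorem expGW_zero {γ : ℝ} (hγ : 0 < γ) : expGW 0 γ = gw (expMeasure (2 * γ)) := by
  have h1 : (γ + 0) / (2 * γ) = 1 / 2 := by field_simp; ring
  have h2 : (γ - 0) / (2 * γ) = 1 / 2 := by field_simp; ring
  rw [expGW, h1, h2]
  rfl

instance (ν : Measure ℝ) [IsProbabilityMeasure ν] : IsProbabilityMeasure (gw ν) where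
  measure_univ := by
    simp [gw, Measure.sum_apply _ MeasurableSet.univ, tsum_shapeWeight]

/-- The branching property at the first vertex below the root. -/
theorem gw_eq (ν : Measure ℝ) [IsProbabilityMeasure ν] :
    gw ν = (2⁻¹ : ℝ≥0∞) • ν.map leaf +
      (2⁻¹ : ℝ≥0∞) • (ν.prod ((gw ν).prod (gw ν))).map mk3 := by
  have h : ν.prod ((gw ν).prod (gw ν)) = Measure.sum fun p : PlaneTree Unit × PlaneTree Unit =>
      (shapeWeight p.1 * shapeWeight p.2) •
        ν.prod ((iidLengths ν p.1).prod (iidLengths ν p.2)) := by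
    rw [gw, Measure.prod_sum, Measure.prod_sum_right]
    congr 1
    ext1 p
    rw [Measure.prod_smul_left, Measure.prod_smul_right, Measure.prod_smul_right,
      Measure.prod_smul_right, smul_smul]
  rw [h, Measure.map_sum measurable_mk3.aemeasurable]
  ext A hA
  rw [gw, Measure.sum_apply _ hA, tsum_shape, Measure.add_apply, Measure.smul_apply,
    Measure.smul_apply, Measure.smul_apply, Measure.sum_apply _ hA, smul_eq_mul, smul_eq_mul,
    smul_eq_mul, ← ENNReal.tsum_mul_left, shapeWeight_leaf]
  congr 1
  refine tsum_congr fun p => ?_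
  rw [Measure.map_smul, Measure.smul_apply, Measure.smul_apply, shapeWeight_node, smul_eq_mul,
    smul_eq_mul]
  simp only [mul_assoc]
  rfl

theorem lintegral_gw (ν : Measure ℝ) [IsProbabilityMeasure ν] {F : PlaneTree ℝ → ℝ≥0∞}
    (hF : Measurable F) :
    ∫⁻ t, F t ∂gw ν = 2⁻¹ * ∫⁻ a, F (leaf a) ∂ν +
      2⁻¹ * ∫⁻ a, ∫⁻ l, ∫⁻ r, F (node a l r) ∂gw ν ∂gw ν ∂ν := by
  conv_lhs => rw [gw_eq]
  have h := hF.comp measurable_mk3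
  rw [lintegral_add_measure, lintegral_smul_measure, lintegral_smul_measure,
    lintegral_map hF measurable_leaf, lintegral_map hF measurable_mk3,
    lintegral_prod (fun x => F (mk3 x)) h.aemeasurable]
  congr 2
  refine lintegral_congr fun a => ?_
  rw [lintegral_prod (fun x => F (mk3 (a, x)))
    (h.comp measurable_prodMk_left).aemeasurable]
  rfl

/-! ### Sorting a tree by Horton–Strahler orders -/

namespace PlaneTree

/-- Sort the two subtrees at each vertex by decreasing order, and mark every edge with its order. -/
def sortMark : PlaneTree ℝ → PlaneTree (ℕ × ℝ)
  | leaf a => leaf (1, a)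
  | node a l r =>
    if r.order ≤ l.order then node ((node a l r).order, a) l.sortMark r.sortMark
    else node ((node a l r).order, a) r.sortMark l.sortMark

theorem measurable_sortMark : Measurable sortMark := by
  have hm : Measurable fun p : ℕ × ℕ => max p.1 p.2 + (if p.1 = p.2 then 1 else 0) :=
    measurable_of_countable _
  have hx : Measurable fun x : ℝ × PlaneTree ℝ × PlaneTree ℝ ×
      PlaneTree (ℕ × ℝ) × PlaneTree (ℕ × ℝ) => (x.2.1.order, x.2.2.1.order) :=
    (measurable_order.comp (by fun_prop)).prodMk (measurable_order.comp (by fun_prop))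
  refine measurable_of_rec (fun a => leaf (1, a))
    (fun a l r l' r' =>
      if r.order ≤ l.order then node ((node a l r).order, a) l' r'
      else node ((node a l r).order, a) r' l') (Measurable.leaf (by fun_prop)) ?_
    (fun _ => rfl) (fun _ _ _ => rfl)
  have ho : Measurable fun x : ℝ × PlaneTree ℝ × PlaneTree ℝ ×
      PlaneTree (ℕ × ℝ) × PlaneTree (ℕ × ℝ) => (node x.1 x.2.1 x.2.2.1).order := hm.comp hx
  refine Measurable.ite ?_ ?_ ?_
  · exact measurableSet_le (hx.snd) (hx.fst)
  · exact Measurable.node (ho.prodMk (by fun_prop)) (by fun_prop) (by fun_prop)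
  · exact Measurable.node (ho.prodMk (by fun_prop)) (by fun_prop) (by fun_prop)

theorem root_sortMark (t : PlaneTree ℝ) : t.sortMark.root.1 = t.order := by
  cases t with
  | leaf a => rfl
  | node a l r => simp only [sortMark]; split_ifs <;> rfl

theorem forget_node_congr {α : Type} (a : α) {l l' r r' : PlaneTree α}
    (hl : l.forget = l'.forget) (hr : r.forget = r'.forget) :
    (node a l r).forget = (node a l' r').forget :=
  (congrArg (Quot.map (ra := Swap) (rb := Swap) (fun u => node a u r) fun _ _ e => .left _ _ e)
    hl).trans (congrArg (Quot.map (ra := Swap) (rb := Swap) (fun u => node a l' u)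
      fun _ _ e => .right _ _ e) hr)

theorem forget_node_swap {α : Type} (a : α) (l r : PlaneTree α) :
    (node a l r).forget = (node a r l).forget := Quot.sound (.swap _ _ _)

/-- Sorting only exchanges siblings, so it is invisible without the embedding; this is how the law
of T[S] will be read off from sorted trees. -/
theorem forget_map_sortMark (t : PlaneTree ℝ) : (t.sortMark.map Prod.snd).forget = t.forget := by
  induction t with
  | leaf a => rfl
  | node a l r ihl ihr =>
    simp only [sortMark]
    split_ifs
    · exact forget_node_congr a ihl ihr
    · exact (forget_node_congr a ihr ihl).trans (forget_node_swap a r l)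

/-- The sorted shape of a tree, marked with orders. -/
def orders (t : PlaneTree ℝ) : PlaneTree ℕ := t.sortMark.map Prod.fst

theorem measurable_orders : Measurable orders :=
  (measurable_map measurable_fst).comp measurable_sortMark

theorem root_map {α β : Type} (f : α → β) (t : PlaneTree α) : (t.map f).root = f t.root := by
  cases t <;> rfl

theorem root_orders (t : PlaneTree ℝ) : t.orders.root = t.order := by
  rw [orders, root_map, root_sortMark]

theorem orders_leaf (a : ℝ) : (leaf a).orders = leaf 1 := rfl

theorem orders_node (a : ℝ) (l r : PlaneTree ℝ) : (node a l r).orders =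
    if r.order ≤ l.order then node (node a l r).order l.orders r.orders
    else node (node a l r).order r.orders l.orders := by
  rw [orders, sortMark]
  split_ifs <;> rfl

end PlaneTree


/-! ### The process law is the sorted Galton–Watson law -/

/-- The order of a vertex whose offspring have orders `i` and `j`. -/
def mergeOrder (i j : ℕ) : ℕ := max i j + (if i = j then 1 else 0)

theorem PlaneTree.order_node {α : Type} (a : α) (l r : PlaneTree α) :
    (node a l r).order = mergeOrder l.order r.order := rfl

theorem mergeOrder_comm (i j : ℕ) : mergeOrder i j = mergeOrder j i := by
  simp only [mergeOrder, max_comm i, eq_comm (a := i)]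

namespace HBP

variable {S : HBP} {γ : ℝ}

/-- The parameters of the critical Tokunaga process. -/
structure IsCriticalTokunaga (S : HBP) (γ : ℝ) : Prop where
  pos : 0 < γ
  lam_eq : ∀ j : ℕ, 1 ≤ j → S.lam j = γ * (2 : ℝ) ^ (2 - (j : ℤ))
  p_eq : ∀ K : ℕ, 1 ≤ K → S.p K = (2 : ℝ) ^ (-(K : ℤ))
  T_eq : ∀ k : ℕ, 1 ≤ k → S.T k = (2 : ℝ) ^ (k - 1)

theorem IsCriticalTokunaga.lam_succ (h : S.IsCriticalTokunaga γ) (j : ℕ) :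
    S.lam (j + 1) = 2 * γ * (1 / 2) ^ j := by
  rw [h.lam_eq _ (by omega), show (2 : ℤ) - ((j + 1 : ℕ) : ℤ) = 1 - (j : ℤ) by push_cast; ring,
    zpow_sub₀ (by norm_num), zpow_one, zpow_natCast, one_div_pow]
  ring

theorem IsCriticalTokunaga.p_of_pos (h : S.IsCriticalTokunaga γ) {K : ℕ} (hK : 1 ≤ K) :
    S.p K = (1 / 2) ^ K := by
  rw [h.p_eq _ hK, zpow_neg, zpow_natCast, one_div_pow, one_div]

/-- T_1 + … + T_j = 2^j − 1, so the total rate is λ_{j+1}·2^j = 2γ. Its independence of the order is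
what makes the edge lengths identically distributed. -/
theorem IsCriticalTokunaga.totalRate_succ (h : S.IsCriticalTokunaga γ) (j : ℕ) :
    S.totalRate (j + 1) = 2 * γ := by
  have h1 : ∑ i ∈ Finset.Ico 1 (j + 1), S.lam (j + 1) * S.T (j + 1 - i) =
      S.lam (j + 1) * (2 ^ j - 1) := by
    rw [← Finset.mul_sum, Finset.sum_Ico_eq_sum_range, ← Finset.sum_range_reflect]
    congr 1
    have hg : (2 : ℝ) ^ j - 1 = ∑ i ∈ Finset.range j, 2 ^ i := by
      rw [geom_sum_eq (by norm_num)]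
      norm_num
    rw [hg]
    refine Finset.sum_congr (by simp) fun i hi => ?_
    have := Finset.mem_range.1 hi
    rw [h.T_eq _ (by omega)]
    congr 1
    omega
  rw [totalRate, h1, h.lam_succ, one_div_pow]
  field_simp
  ring

/-- The probability that the root branch has order `j`. -/
def rootWeight (j : ℕ) : ℝ≥0∞ := if j = 0 then 0 else ENNReal.ofReal ((1 / 2) ^ j)

theorem IsCriticalTokunaga.rootWeight_eq (h : S.IsCriticalTokunaga γ) {j : ℕ} (hj : 1 ≤ j) :
    rootWeight j = ENNReal.ofReal (S.p j) := by
  rw [rootWeight, if_neg (by omega), h.p_of_pos hj]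

/-- The balance between the rates of the process and the Galton-Watson weights. -/
theorem IsCriticalTokunaga.weight_balance (h : S.IsCriticalTokunaga γ) (j i k : ℕ) :
    2⁻¹ * ((if k ≤ i ∧ j = mergeOrder i k then 1 else 0) +
      (if k < i ∧ j = mergeOrder i k then 1 else 0)) * (rootWeight i * rootWeight k) =
    rootWeight j * ENNReal.ofReal (S.rate j (some (i, k)) / S.totalRate j) := by
  have hγ := h.pos
  rcases Nat.eq_zero_or_pos i with rfl | hi
  -- Order 0 never occurs: `rootWeight` vanishes there, and every rate involving it is zero.
  · have : rootWeight 0 = 0 := rfl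
    by_cases hj : j = 0
    · subst hj; simp [this]
    · have e : S.rate j (some (0, k)) = 0 := by
        rw [rate, if_neg (by omega), if_neg (by omega)]
      simp [this, e]
  rcases Nat.eq_zero_or_pos k with rfl | hk
  · have : rootWeight 0 = 0 := rfl
    by_cases hj : j = 0
    · subst hj; simp [this]
    · have e : S.rate j (some (i, 0)) = 0 := by
        rw [rate, if_neg (by omega), if_neg (by omega)]
      simp [this, e]
  have hw : ∀ m, 1 ≤ m → rootWeight m = ENNReal.ofReal ((1 / 2) ^ m) := fun m hm => by
    rw [rootWeight, if_neg (by omega)]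
  -- The larger order is listed first, so i < k has no mass. For i = k both sides are 2^(−2i−1), at
  -- j = i + 1. For i > k both sides are 2^(−i−k), at j = i; here the two embeddings of the pair
  -- cancel the factor 1/2.
  rcases lt_trichotomy i k with hik | hik | hik
  · have e : S.rate j (some (i, k)) = 0 := by
      rw [rate, if_neg (by omega), if_neg (by omega)]
    rw [if_neg (by omega), if_neg (by omega), e]
    simp
  · subst hik
    have hm : mergeOrder i i = i + 1 := by simp [mergeOrder]
    by_cases hj : j = i + 1
    · subst hj
      rw [hm, if_pos ⟨le_rfl, rfl⟩, if_neg (by omega), rate, if_neg (by omega),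
        if_pos (by omega), h.totalRate_succ, h.lam_succ, hw _ hi, hw _ (by omega), ← ofReal_half,
        add_zero, mul_one, ← ENNReal.ofReal_mul (by positivity),
        ← ENNReal.ofReal_mul (by positivity), ← ENNReal.ofReal_mul (by positivity)]
      congr 1
      field_simp
      ring
    · rw [hm, if_neg (by omega), if_neg (by omega), rate, if_neg (by omega), if_neg (by omega)]
      simp
  · have hm : mergeOrder i k = i := by simp [mergeOrder, hik.le, hik.ne']
    by_cases hj : j = i
    · subst hj
      obtain ⟨d, rfl⟩ : ∃ d, j = k + d + 1 := ⟨j - k - 1, by omega⟩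
      rw [hm, if_pos ⟨hik.le, rfl⟩, if_pos ⟨hik, rfl⟩, rate, if_pos ⟨rfl, hk, hik⟩,
        h.totalRate_succ, h.lam_succ, h.T_eq _ (by omega), hw _ hi, hw _ hk, one_add_one_eq_two,
        ENNReal.inv_mul_cancel (by norm_num) (by norm_num), one_mul,
        ← ENNReal.ofReal_mul (by positivity), ← ENNReal.ofReal_mul (by positivity)]
      congr 2
      rw [show k + d + 1 - k - 1 = d by omega]
      have h2 : (1 / 2 : ℝ) ^ d * 2 ^ d = 1 := by rw [← mul_pow]; norm_num
      field_simp
      rw [pow_add, mul_assoc, h2, mul_one]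
    · rw [hm, if_neg (by omega), if_neg (by omega), rate, if_neg (by omega), if_neg (by omega)]
      simp

instance sFinite_expMeasure (r : ℝ) : SFinite (expMeasure r) := by
  unfold expMeasure gammaMeasure
  infer_instance

instance sFinite_historyLaw (s : PlaneTree ℕ) : SFinite (S.historyLaw s) := by
  induction s with
  | leaf j => rw [historyLaw]; infer_instance
  | node j l r ihl ihr => rw [historyLaw]; infer_instance

theorem lintegral_historyLaw_leaf (j : ℕ) {F : PlaneTree (ℕ × ℝ) → ℝ≥0∞} (hF : Measurable F) :
    ∫⁻ t, F t ∂S.historyLaw (leaf j) = ENNReal.ofReal (S.rate j none / S.totalRate j) *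
      ∫⁻ a, F (leaf (j, a)) ∂expMeasure (S.totalRate j) := by
  rw [historyLaw, lintegral_smul_measure, lintegral_map hF (Measurable.leaf (by fun_prop)),
    smul_eq_mul]

theorem lintegral_historyLaw_node (j : ℕ) (l r : PlaneTree ℕ) {F : PlaneTree (ℕ × ℝ) → ℝ≥0∞}
    (hF : Measurable F) :
    ∫⁻ t, F t ∂S.historyLaw (node j l r) =
      ENNReal.ofReal (S.rate j (some (l.root, r.root)) / S.totalRate j) *
      ∫⁻ a, ∫⁻ x, ∫⁻ y, F (node (j, a) x y) ∂S.historyLaw r ∂S.historyLaw l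
        ∂expMeasure (S.totalRate j) := by
  have hm : Measurable fun x : ℝ × PlaneTree (ℕ × ℝ) × PlaneTree (ℕ × ℝ) =>
      node (j, x.1) x.2.1 x.2.2 := Measurable.node (by fun_prop) (by fun_prop) (by fun_prop)
  rw [historyLaw, lintegral_smul_measure, lintegral_map hF hm, smul_eq_mul,
    lintegral_prod (fun x : ℝ × PlaneTree (ℕ × ℝ) × PlaneTree (ℕ × ℝ) =>
      F (node (j, x.1) x.2.1 x.2.2)) (hF.comp hm).aemeasurable]
  congr 1
  refine lintegral_congr fun a => ?_
  rw [lintegral_prod (fun x : PlaneTree (ℕ × ℝ) × PlaneTree (ℕ × ℝ) => F (node (j, a) x.1 x.2))]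
  exact (hF.comp (Measurable.node (by fun_prop) (by fun_prop) (by fun_prop))).aemeasurable

theorem measurableSet_orders_eq (s : PlaneTree ℕ) :
    MeasurableSet {t : PlaneTree ℝ | t.orders = s} :=
  measurable_orders (measurableSet_singleton s)

/-- The branching history with orders `s` is the sorted Galton-Watson tree with orders `s`. -/
theorem IsCriticalTokunaga.lintegral_historyLaw (h : S.IsCriticalTokunaga γ) (s : PlaneTree ℕ)
    {F : PlaneTree (ℕ × ℝ) → ℝ≥0∞} (hF : Measurable F) :
    ∫⁻ t, {t | t.orders = s}.indicator (fun t => F t.sortMark) t ∂gw (expMeasure (2 * γ)) =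
      rootWeight s.root * ∫⁻ t, F t ∂S.historyLaw s := by
  have hγ := h.pos
  have : IsProbabilityMeasure (expMeasure (2 * γ)) :=
    isProbabilityMeasure_expMeasure (by positivity)
  classical
  induction s generalizing F with
  | leaf j =>
    have hFs : Measurable fun t => F (sortMark t) := hF.comp measurable_sortMark
    rw [lintegral_gw _ (hFs.indicator (measurableSet_orders_eq _)),
      lintegral_historyLaw_leaf j hF]
    have h0 : ∀ a l r, {t : PlaneTree ℝ | t.orders = leaf j}.indicator
        (fun t => F t.sortMark) (node a l r) = 0 := fun a l r => by
      refine Set.indicator_of_notMem ?_ _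
      rw [Set.mem_ofPred_eq, orders_node]
      split_ifs <;> simp
    simp_rw [h0]
    by_cases hj : j = 1
    · subst hj
      have h1 : ∀ a, {t : PlaneTree ℝ | t.orders = leaf 1}.indicator
          (fun t => F t.sortMark) (leaf a) = F (leaf (1, a)) := fun a =>
        Set.indicator_of_mem (by exact orders_leaf a) _
      have h2 : S.lam 1 = 2 * γ := by simpa using h.lam_succ 0
      have h3 := h.totalRate_succ 0
      rw [zero_add] at h3
      simp_rw [h1]
      rw [h3, rate, if_pos rfl, h2, div_self (by positivity)]
      simp [root, rootWeight]
    · have h1 : ∀ a, {t : PlaneTree ℝ | t.orders = leaf j}.indicator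
          (fun t => F t.sortMark) (leaf a) = 0 := fun a => by
        refine Set.indicator_of_notMem ?_ _
        rw [Set.mem_ofPred_eq, orders_leaf]
        simp [Ne.symm hj]
      simp_rw [h1]
      rw [rate, if_neg hj]
      simp
  | node j l r ihl ihr =>
    set μ := gw (expMeasure (2 * γ)) with hμ
    -- A tree with subtrees x, y is sorted to `node j l r` either as it stands or after an exchange.
    -- `c₁` and `c₂` record the conditions on the orders in these two cases; the strict inequality
    -- in `c₂` makes ties count once.
    set c₁ : ℝ≥0∞ := if r.root ≤ l.root ∧ j = mergeOrder l.root r.root then 1 else 0 with hc₁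
    set c₂ : ℝ≥0∞ := if r.root < l.root ∧ j = mergeOrder l.root r.root then 1 else 0 with hc₂
    let K : ℝ → PlaneTree ℝ → PlaneTree ℝ → ℝ≥0∞ := fun a x y =>
      {t | t.orders = l}.indicator (fun x => {t | t.orders = r}.indicator
        (fun y => F (node (j, a) x.sortMark y.sortMark)) y) x
    have hK : Measurable fun p : ℝ × PlaneTree ℝ × PlaneTree ℝ => K p.1 p.2.1 p.2.2 := by
      have e : (fun p : ℝ × PlaneTree ℝ × PlaneTree ℝ => K p.1 p.2.1 p.2.2) =
          ({p | p.2.1.orders = l} ∩ {p | p.2.2.orders = r}).indicator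
            (fun p => F (node (j, p.1) p.2.1.sortMark p.2.2.sortMark)) := by
        ext p
        rw [← Set.indicator_indicator]
        rfl
      rw [e]
      refine (hF.comp (Measurable.node (by fun_prop) (measurable_sortMark.comp (by fun_prop))
        (measurable_sortMark.comp (by fun_prop)))).indicator (MeasurableSet.inter ?_ ?_)
      · exact (measurable_orders.comp (measurable_fst.comp measurable_snd))
          (measurableSet_singleton l)
      · exact (measurable_orders.comp (measurable_snd.comp measurable_snd))
          (measurableSet_singleton r)
    have hz : ∀ {P Q : Prop} (z : ℝ≥0∞), ¬ (P ∧ Q) →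
        (if P then if Q then z else 0 else 0) = 0 := fun z hPQ => by
      rw [← ite_and, if_neg hPQ]
    have hpt : ∀ a x y, {t : PlaneTree ℝ | t.orders = node j l r}.indicator
        (fun t => F t.sortMark) (node a x y) = c₁ * K a x y + c₂ * K a y x := by
      intro a x y
      have hx := root_orders x
      have hy := root_orders y
      by_cases hxy : y.order ≤ x.order
      · have ho : (node a x y).orders =
            node (mergeOrder x.order y.order) x.orders y.orders := by
          rw [orders_node, if_pos hxy, order_node]
        have hs : (node a x y).sortMark =
            node (mergeOrder x.order y.order, a) x.sortMark y.sortMark := by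
          rw [sortMark, if_pos hxy, order_node]
        simp only [K, Set.indicator_apply, Set.mem_ofPred_eq, ho, hs, hc₁, hc₂]
        by_cases h1 : x.orders = l ∧ y.orders = r
        · obtain ⟨rfl, rfl⟩ := h1
          rw [hx, hy]
          by_cases h2 : j = mergeOrder x.order y.order
          · subst h2
            -- If x and y sort to the same tree, both matchings hold, but then the orders tie and
            -- `c₂` vanishes.
            have h3 : ¬ y.order < x.order ∨ ¬ (y.orders = x.orders) := by
              by_cases h4 : y.orders = x.orders
              · left
                rw [← hx, ← hy, h4]
                exact lt_irrefl _
              · exact .inr h4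
            rcases h3 with h3 | h3 <;> simp [hxy, h3]
          · simp [h2, Ne.symm h2]
        · rw [if_neg (fun e => h1 ⟨(node.inj e).2.1, (node.inj e).2.2⟩), hz _ h1]
          by_cases h2 : y.orders = l ∧ x.orders = r
          · rw [← h2.1, ← h2.2, mul_zero, zero_add, if_neg (by omega), zero_mul]
          · rw [hz _ h2]
            simp
      · have ho : (node a x y).orders =
            node (mergeOrder x.order y.order) y.orders x.orders := by
          rw [orders_node, if_neg hxy, order_node]
        have hs : (node a x y).sortMark =
            node (mergeOrder x.order y.order, a) y.sortMark x.sortMark := by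
          rw [sortMark, if_neg hxy, order_node]
        simp only [K, Set.indicator_apply, Set.mem_ofPred_eq, ho, hs, hc₁, hc₂]
        by_cases h1 : y.orders = l ∧ x.orders = r
        · obtain ⟨rfl, rfl⟩ := h1
          rw [hx, hy]
          have h3 : ¬ (x.orders = y.orders) := fun h4 => by
            rw [h4] at hx
            omega
          by_cases h2 : j = mergeOrder y.order x.order
          · rw [mergeOrder_comm x.order y.order, ← h2]
            simp [h3, not_le.1 hxy]
          · rw [mergeOrder_comm x.order y.order]
            simp [h2, Ne.symm h2]
        · rw [if_neg (fun e => h1 ⟨(node.inj e).2.1, (node.inj e).2.2⟩), hz _ h1]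
          by_cases h2 : x.orders = l ∧ y.orders = r
          · rw [← h2.1, ← h2.2, if_neg (by omega)]
            simp
          · rw [hz _ h2]
            simp
    -- The two subtrees are independent, so the induction hypotheses apply to one variable at a
    -- time.
    have hJ : ∀ a, ∫⁻ x, ∫⁻ y, K a x y ∂μ ∂μ = rootWeight l.root * rootWeight r.root *
        ∫⁻ x, ∫⁻ y, F (node (j, a) x y) ∂S.historyLaw r ∂S.historyLaw l := by
      intro a
      have hFa : Measurable fun p : PlaneTree (ℕ × ℝ) × PlaneTree (ℕ × ℝ) =>
          F (node (j, a) p.1 p.2) :=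
        hF.comp (Measurable.node (by fun_prop) (by fun_prop) (by fun_prop))
      have e : ∀ x, ∫⁻ y, K a x y ∂μ = {t | t.orders = l}.indicator
          (fun x => rootWeight r.root *
            ∫⁻ y, F (node (j, a) x.sortMark y) ∂S.historyLaw r) x := by
        intro x
        by_cases hx : x.orders = l
        · rw [Set.indicator_of_mem (by exact hx),
            ← ihr (F := fun y => F (node (j, a) x.sortMark y)) (hFa.comp measurable_prodMk_left)]
          refine lintegral_congr fun y => ?_
          exact Set.indicator_of_mem (by exact hx) _
        · rw [Set.indicator_of_notMem (by exact hx)]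
          have : ∀ y, K a x y = 0 := fun y => Set.indicator_of_notMem (by exact hx) _
          simp [this]
      simp_rw [e]
      rw [ihl (F := fun x => rootWeight r.root *
          ∫⁻ y, F (node (j, a) x y) ∂S.historyLaw r) (hFa.lintegral_prod_right'.const_mul _),
        lintegral_const_mul _ hFa.lintegral_prod_right', mul_assoc]
    -- By Tonelli the exchanged term has the same integral, so the two embeddings only contribute
    -- the factor `c₁ + c₂`.
    have hJ' : ∀ a, ∫⁻ x, ∫⁻ y, (c₁ * K a x y + c₂ * K a y x) ∂μ ∂μ =
        (c₁ + c₂) * (rootWeight l.root * rootWeight r.root) *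
          ∫⁻ x, ∫⁻ y, F (node (j, a) x y) ∂S.historyLaw r ∂S.historyLaw l := by
      intro a
      have hKa : Measurable fun p : PlaneTree ℝ × PlaneTree ℝ => K a p.1 p.2 :=
        hK.comp measurable_prodMk_left
      have hKs : Measurable fun p : PlaneTree ℝ × PlaneTree ℝ => K a p.2 p.1 :=
        hKa.comp measurable_swap
      have m1 : ∀ x, Measurable fun y => K a x y := fun x => hKa.comp measurable_prodMk_left
      have m2 : ∀ x, Measurable fun y => K a y x := fun x => hKs.comp measurable_prodMk_left
      have e1 : ∀ x, ∫⁻ y, (c₁ * K a x y + c₂ * K a y x) ∂μ =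
          c₁ * ∫⁻ y, K a x y ∂μ + c₂ * ∫⁻ y, K a y x ∂μ := fun x => by
        rw [lintegral_add_left ((m1 x).const_mul _), lintegral_const_mul _ (m1 x),
          lintegral_const_mul _ (m2 x)]
      simp_rw [e1]
      rw [lintegral_add_left (hKa.lintegral_prod_right'.const_mul _),
        lintegral_const_mul _ hKa.lintegral_prod_right',
        lintegral_const_mul _ hKs.lintegral_prod_right',
        lintegral_lintegral_swap (f := fun x y => K a y x) hKs.aemeasurable, hJ a, ← add_mul,
        mul_assoc (c₁ + c₂)]
    have hFs : Measurable fun t => F (sortMark t) := hF.comp measurable_sortMark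
    rw [lintegral_gw _ (hFs.indicator (measurableSet_orders_eq _)),
      lintegral_historyLaw_node j l r hF, ← hμ]
    have h0 : ∀ a, {t : PlaneTree ℝ | t.orders = node j l r}.indicator
        (fun t => F t.sortMark) (leaf a) = 0 := fun a =>
      Set.indicator_of_notMem (by simp [orders_leaf]) _
    simp_rw [h0, hpt, hJ']
    have hH : Measurable fun a => ∫⁻ x, ∫⁻ y, F (node (j, a) x y)
        ∂S.historyLaw r ∂S.historyLaw l := by
      have h1 : Measurable fun p : (ℝ × PlaneTree (ℕ × ℝ)) × PlaneTree (ℕ × ℝ) =>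
          F (node (j, p.1.1) p.1.2 p.2) :=
        hF.comp (Measurable.node (by fun_prop) (by fun_prop) (by fun_prop))
      exact h1.lintegral_prod_right'.lintegral_prod_right'
    rw [lintegral_const_mul _ hH, lintegral_zero, mul_zero, zero_add, ← mul_assoc,
      ← mul_assoc 2⁻¹, hc₁, hc₂, h.weight_balance, mul_assoc]
    change _ = rootWeight j * _
    -- The total rate at index 0 is not known to be 2γ, but the weight of order 0 vanishes.
    rcases Nat.eq_zero_or_pos j with rfl | hj
    · simp [rootWeight]
    · obtain ⟨i, rfl⟩ : ∃ i, j = i + 1 := ⟨j - 1, by omega⟩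
      rw [h.totalRate_succ]

/-- Every tree has exactly one sorted order-marked shape, so summing `lintegral_historyLaw` over
these shapes recovers the whole Galton–Watson integral. -/
theorem IsCriticalTokunaga.processLaw_eq (h : S.IsCriticalTokunaga γ) :
    S.processLaw = (gw (expMeasure (2 * γ))).map sortMark := by
  have hγ := h.pos
  refine Measure.ext_of_lintegral _ fun F hF => ?_
  rw [processLaw, lintegral_sum_measure, lintegral_map hF measurable_sortMark]
  have h1 : ∀ s : PlaneTree ℕ, ∫⁻ t, F t ∂(ENNReal.ofReal (S.p s.root) • S.historyLaw s) =
      ∫⁻ t, {t | t.orders = s}.indicator (fun t => F t.sortMark) t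
        ∂gw (expMeasure (2 * γ)) := by
    intro s
    rw [h.lintegral_historyLaw s hF, lintegral_smul_measure, smul_eq_mul]
    -- `S.p 0` is arbitrary and may differ from `rootWeight 0`, but all transition rates of order 0
    -- are zero, so the history law vanishes.
    rcases Nat.eq_zero_or_pos s.root with h0 | h0
    · have : S.historyLaw s = 0 := by
        cases s with
        | leaf j =>
          change j = 0 at h0
          subst h0
          simp [historyLaw, rate]
        | node j l r =>
          change j = 0 at h0
          subst h0
          simp [historyLaw, rate]
      simp [this]
    · rw [h.rootWeight_eq h0]
  simp_rw [h1]
  have hFs : Measurable fun t => F (sortMark t) := hF.comp measurable_sortMark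
  rw [← lintegral_tsum fun s =>
    (hFs.indicator (measurableSet_orders_eq s)).aemeasurable]
  refine lintegral_congr fun t => ?_
  rw [tsum_eq_single t.orders fun s hs => Set.indicator_of_notMem (by exact hs.symm) _]
  exact Set.indicator_of_mem (by exact rfl) _

theorem IsCriticalTokunaga.treeLaw_eq (h : S.IsCriticalTokunaga γ) :
    S.treeLaw = (gw (expMeasure (2 * γ))).map forget := by
  have hm : Measurable fun t : PlaneTree (ℕ × ℝ) => (t.map Prod.snd).forget :=
    measurable_forget.comp (measurable_map measurable_snd)
  rw [treeLaw, h.processLaw_eq, Measure.map_map hm measurable_sortMark]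
  congr 1
  ext t
  exact forget_map_sortMark t

end HBP

/-! ### Scaling and geometric sums of exponential laws -/

section Exponential

theorem lintegral_Ioc_of_hasDerivAt {F f : ℝ → ℝ} {c : ℝ} (hc : 0 ≤ c)
    (hF : ∀ x, HasDerivAt F (f x) x) (hf : Continuous f) (h0 : ∀ x ∈ Set.Ioc 0 c, 0 ≤ f x) :
    ∫⁻ x in Set.Ioc 0 c, ENNReal.ofReal (f x) = ENNReal.ofReal (F c - F 0) := by
  rw [← intervalIntegral.integral_eq_sub_of_hasDerivAt (fun x _ => hF x)
    (hf.intervalIntegrable 0 c), intervalIntegral.integral_of_le hc,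
    ofReal_integral_eq_lintegral_ofReal]
  · exact (hf.integrableOn_Icc).mono_set Set.Ioc_subset_Icc_self
  · exact (ae_restrict_iff' measurableSet_Ioc).2 (Filter.Eventually.of_forall h0)

theorem lintegral_expMeasure {r : ℝ} {f : ℝ → ℝ≥0∞} (hf : Measurable f) :
    ∫⁻ a, f a ∂expMeasure r = ∫⁻ a in Set.Ioi 0, ENNReal.ofReal (r * Real.exp (-(r * a))) * f a := by
  have h : Measurable (exponentialPDF r) := (measurable_exponentialPDFReal r).ennreal_ofReal
  change ∫⁻ a, f a ∂(volume.withDensity (exponentialPDF r)) = _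
  rw [lintegral_withDensity_eq_lintegral_mul _ h hf, Measure.restrict_congr_set Ioi_ae_eq_Ici,
    ← lintegral_indicator measurableSet_Ici]
  refine lintegral_congr fun a => ?_
  by_cases ha : 0 ≤ a
  · rw [Set.indicator_of_mem (by exact ha), Pi.mul_apply, exponentialPDF_of_nonneg ha]
  · rw [Set.indicator_of_notMem (by exact ha), Pi.mul_apply, exponentialPDF_of_neg (not_le.1 ha),
      zero_mul]

theorem expMeasure_Iic {r : ℝ} (hr : 0 < r) (x : ℝ) :
    expMeasure r (Set.Iic x) =
      ENNReal.ofReal (if 0 ≤ x then 1 - Real.exp (-(r * x)) else 0) := by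
  have := isProbabilityMeasure_expMeasure hr
  rw [← cdf_expMeasure_eq hr, ofReal_cdf]

theorem map_two_mul_expMeasure {γ : ℝ} (hγ : 0 < γ) :
    (expMeasure (2 * γ)).map (fun x => 2 * x) = expMeasure γ := by
  have h1 := isProbabilityMeasure_expMeasure hγ
  have h2 := isProbabilityMeasure_expMeasure (show 0 < 2 * γ by positivity)
  have hm : Measurable fun x : ℝ => 2 * x := by fun_prop
  have h3 := Measure.isProbabilityMeasure_map (μ := expMeasure (2 * γ)) hm.aemeasurable
  refine Measure.ext_of_Iic _ _ fun x => ?_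
  rw [Measure.map_apply hm measurableSet_Iic, expMeasure_Iic hγ]
  have : (fun x : ℝ => 2 * x) ⁻¹' Set.Iic x = Set.Iic (x / 2) := by
    ext y
    simp only [Set.mem_preimage, Set.mem_Iic]
    constructor <;> intro h <;> linarith
  rw [this, expMeasure_Iic (by positivity)]
  congr 1
  have h4 : 0 ≤ x / 2 ↔ 0 ≤ x := by constructor <;> intro h <;> linarith
  simp only [h4, show 2 * γ * (x / 2) = γ * x by ring]

/-- A geometric sum of exponential times is exponential. -/
theorem expMeasure_eq_half_add {γ : ℝ} (hγ : 0 < γ) :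
    expMeasure γ = (2⁻¹ : ℝ≥0∞) • expMeasure (2 * γ) +
      (2⁻¹ : ℝ≥0∞) • ((expMeasure (2 * γ)).prod (expMeasure γ)).map fun p => p.1 + p.2 := by
  have h1 := isProbabilityMeasure_expMeasure hγ
  have h2 := isProbabilityMeasure_expMeasure (show 0 < 2 * γ by positivity)
  have hm : Measurable fun p : ℝ × ℝ => p.1 + p.2 := by fun_prop
  refine Measure.ext_of_Iic _ _ fun x => ?_
  have hpre : ∀ a : ℝ, Prod.mk a ⁻¹' ((fun p : ℝ × ℝ => p.1 + p.2) ⁻¹' Set.Iic x) =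
      Set.Iic (x - a) := by
    intro a
    ext y
    simp only [Set.mem_preimage, Set.mem_Iic]
    constructor <;> intro h <;> linarith
  rw [Measure.add_apply, Measure.smul_apply, Measure.smul_apply,
    Measure.map_apply hm measurableSet_Iic, Measure.prod_apply (hm measurableSet_Iic)]
  simp_rw [hpre]
  have hmeas : Measurable fun a => expMeasure γ (Set.Iic (x - a)) := by
    simp_rw [expMeasure_Iic hγ]
    refine Measurable.ennreal_ofReal (Measurable.ite ?_ (by fun_prop) measurable_const)
    exact measurableSet_le measurable_const (by fun_prop)
  rw [lintegral_expMeasure hmeas]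
  simp_rw [expMeasure_Iic hγ]
  rw [expMeasure_Iic (by positivity : 0 < 2 * γ), smul_eq_mul, smul_eq_mul]
  by_cases hx : 0 ≤ x
  · have hle : ∀ a, 0 ≤ a → a ≤ x → 0 ≤ 1 - Real.exp (-(γ * (x - a))) := fun a _ ha => by
      rw [sub_nonneg, Real.exp_le_one_iff]
      nlinarith
    have e : ∫⁻ a in Set.Ioi 0, ENNReal.ofReal (2 * γ * Real.exp (-(2 * γ * a))) *
        ENNReal.ofReal (if 0 ≤ x - a then 1 - Real.exp (-(γ * (x - a))) else 0) =
        ∫⁻ a in Set.Ioc 0 x, ENNReal.ofReal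
          (2 * γ * Real.exp (-(2 * γ * a)) * (1 - Real.exp (-(γ * (x - a))))) := by
      rw [← lintegral_indicator measurableSet_Ioi, ← lintegral_indicator measurableSet_Ioc]
      refine lintegral_congr fun a => ?_
      by_cases ha : 0 < a
      · rw [Set.indicator_of_mem (by exact ha)]
        by_cases hax : a ≤ x
        · rw [Set.indicator_of_mem (by exact ⟨ha, hax⟩), if_pos (by linarith),
            ← ENNReal.ofReal_mul (by positivity)]
        · rw [Set.indicator_of_notMem (fun h => hax h.2), if_neg (by linarith),
            ENNReal.ofReal_zero, mul_zero]
      · rw [Set.indicator_of_notMem (by exact ha), Set.indicator_of_notMem (fun h => ha h.1)]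
    -- The integrand is 2γe^(−2γa) − 2γe^(−γx)e^(−γa), with this explicit primitive, whose increment
    -- is (1 − e^(−γx))². Its average with 1 − e^(−2γx) is 1 − e^(−γx).
    rw [e, lintegral_Ioc_of_hasDerivAt (F := fun a => -Real.exp (-(2 * γ * a)) +
      2 * Real.exp (-(γ * x)) * Real.exp (-(γ * a))) hx ?_ (by fun_prop) ?_]
    · rw [if_pos hx, if_pos hx, ← mul_add, ← ENNReal.ofReal_add, ← ofReal_half,
        ← ENNReal.ofReal_mul (by positivity)]
      · congr 1
        have : Real.exp (-(2 * γ * x)) = Real.exp (-(γ * x)) * Real.exp (-(γ * x)) := by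
          rw [← Real.exp_add]; ring_nf
        simp only [this, mul_zero, neg_zero, Real.exp_zero]
        ring
      · rw [sub_nonneg, Real.exp_le_one_iff]
        nlinarith
      · have : Real.exp (-(2 * γ * x)) = Real.exp (-(γ * x)) * Real.exp (-(γ * x)) := by
          rw [← Real.exp_add]; ring_nf
        simp only [this, mul_zero, neg_zero, Real.exp_zero]
        nlinarith [sq_nonneg (1 - Real.exp (-(γ * x)))]
    · intro a
      have d1 : HasDerivAt (fun a => Real.exp (-(2 * γ * a)))
          (Real.exp (-(2 * γ * a)) * (-(2 * γ * 1))) a :=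
        (((hasDerivAt_id a).const_mul (2 * γ)).neg).exp
      have d2 : HasDerivAt (fun a => Real.exp (-(γ * a)))
          (Real.exp (-(γ * a)) * (-(γ * 1))) a :=
        (((hasDerivAt_id a).const_mul γ).neg).exp
      refine (d1.neg.add (d2.const_mul (2 * Real.exp (-(γ * x))))).congr_deriv ?_
      have e2 : Real.exp (-(γ * x)) * Real.exp (-(γ * a)) =
          Real.exp (-(2 * γ * a)) * Real.exp (-(γ * (x - a))) := by
        rw [← Real.exp_add, ← Real.exp_add]; ring_nf
      linear_combination (-2 * γ) * e2
    · intro a ha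
      exact mul_nonneg (by positivity) (hle a ha.1.le ha.2)
  · have e : ∀ a ∈ Set.Ioi (0 : ℝ), ENNReal.ofReal (2 * γ * Real.exp (-(2 * γ * a))) *
        ENNReal.ofReal (if 0 ≤ x - a then 1 - Real.exp (-(γ * (x - a))) else 0) = 0 := by
      intro a ha
      have ha : 0 < a := ha
      rw [if_neg (by linarith), ENNReal.ofReal_zero, mul_zero]
    rw [setLIntegral_congr_fun measurableSet_Ioi e, if_neg hx, if_neg hx]
    simp

theorem lintegral_expMeasure_half {γ : ℝ} (hγ : 0 < γ) {h : ℝ → ℝ≥0∞} (hh : Measurable h) :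
    ∫⁻ a, h a ∂expMeasure γ = 2⁻¹ * ∫⁻ a, h a ∂expMeasure (2 * γ) +
      2⁻¹ * ∫⁻ a, ∫⁻ b, h (a + b) ∂expMeasure γ ∂expMeasure (2 * γ) := by
  have hm : Measurable fun p : ℝ × ℝ => p.1 + p.2 := by fun_prop
  have hc : Measurable fun p : ℝ × ℝ => h (p.1 + p.2) := hh.comp hm
  conv_lhs => rw [expMeasure_eq_half_add hγ]
  rw [lintegral_add_measure, lintegral_smul_measure, lintegral_smul_measure,
    lintegral_map hh hm, lintegral_prod _ hc.aemeasurable, smul_eq_mul, smul_eq_mul]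

end Exponential

/-! ### Horton pruning of the Galton–Watson tree -/

namespace PlaneTree

theorem measurable_elongate : Measurable fun p : ℝ × PlaneTree ℝ => p.2.elongate p.1 := by
  have h : (fun p : ℝ × PlaneTree ℝ => p.2.elongate p.1) = fun p =>
      if p.2.IsLeaf then leaf (p.1 + p.2.root) else node (p.1 + p.2.root) p.2.lft p.2.rgt := by
    ext ⟨c, t⟩
    cases t <;> rfl
  rw [h]
  have hr : Measurable fun p : ℝ × PlaneTree ℝ => p.1 + p.2.root :=
    measurable_fst.add (measurable_root.comp measurable_snd)
  exact Measurable.ite (measurable_snd measurableSet_isLeaf) hr.leaf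
    (hr.node (measurable_lft.comp measurable_snd) (measurable_rgt.comp measurable_snd))

/-- The pruned tree; a tree with a single edge is returned unchanged. -/
def pruneTotal : PlaneTree ℝ → PlaneTree ℝ
  | leaf a => leaf a
  | node a l r =>
    if l.IsLeaf then if r.IsLeaf then leaf a else r.pruneTotal.elongate a
    else if r.IsLeaf then l.pruneTotal.elongate a else node a l.pruneTotal r.pruneTotal

theorem prune_eq (t : PlaneTree ℝ) : t.prune = if t.IsLeaf then none else some t.pruneTotal := by
  induction t with
  | leaf a => rfl
  | node a l r ihl ihr =>
    rw [prune, ihl, ihr, pruneTotal, if_neg (not_isLeaf_node a l r)]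
    split_ifs <;> rfl

theorem measurable_pruneTotal : Measurable pruneTotal := by
  refine measurable_of_rec leaf (fun a l r l' r' =>
    if l.IsLeaf then if r.IsLeaf then leaf a else r'.elongate a
    else if r.IsLeaf then l'.elongate a else node a l' r') measurable_leaf ?_ (fun _ => rfl)
    (fun _ _ _ => rfl)
  have h1 : MeasurableSet {x : ℝ × PlaneTree ℝ × PlaneTree ℝ × PlaneTree ℝ × PlaneTree ℝ |
      x.2.1.IsLeaf} := (measurable_fst.comp measurable_snd) measurableSet_isLeaf
  have h2 : MeasurableSet {x : ℝ × PlaneTree ℝ × PlaneTree ℝ × PlaneTree ℝ × PlaneTree ℝ |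
      x.2.2.1.IsLeaf} :=
    (measurable_fst.comp (measurable_snd.comp measurable_snd)) measurableSet_isLeaf
  refine Measurable.ite h1 (Measurable.ite h2 (Measurable.leaf (by fun_prop)) ?_)
    (Measurable.ite h2 ?_ (Measurable.node (by fun_prop) (by fun_prop) (by fun_prop)))
  · exact measurable_elongate.comp (measurable_fst.prodMk
      (measurable_snd.comp (measurable_snd.comp (measurable_snd.comp measurable_snd))))
  · exact measurable_elongate.comp (measurable_fst.prodMk
      (measurable_fst.comp (measurable_snd.comp (measurable_snd.comp measurable_snd))))

end PlaneTree

/-- The law of the three parts of a Galton-Watson tree that is not a single edge. -/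
def gwParts (ν : Measure ℝ) : Measure (ℝ × PlaneTree ℝ × PlaneTree ℝ) :=
  ν.prod ((gw ν).prod (gw ν))

instance (ν : Measure ℝ) [IsProbabilityMeasure ν] : IsProbabilityMeasure (gwParts ν) := by
  unfold gwParts; infer_instance

theorem lintegral_gwParts (ν : Measure ℝ) [IsProbabilityMeasure ν]
    {F : ℝ × PlaneTree ℝ × PlaneTree ℝ → ℝ≥0∞} (hF : Measurable F) :
    ∫⁻ x, F x ∂gwParts ν = ∫⁻ a, ∫⁻ l, ∫⁻ r, F (a, l, r) ∂gw ν ∂gw ν ∂ν := by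
  rw [gwParts, lintegral_prod _ hF.aemeasurable]
  refine lintegral_congr fun a => ?_
  rw [lintegral_prod (fun x => F (a, x)) (hF.comp measurable_prodMk_left).aemeasurable]

theorem lintegral_gw_parts (ν : Measure ℝ) [IsProbabilityMeasure ν] {F : PlaneTree ℝ → ℝ≥0∞}
    (hF : Measurable F) :
    ∫⁻ t, F t ∂gw ν = 2⁻¹ * ∫⁻ a, F (leaf a) ∂ν + 2⁻¹ * ∫⁻ x, F (mk3 x) ∂gwParts ν := by
  rw [lintegral_gw ν hF, lintegral_gwParts ν (F := fun x => F (mk3 x)) (hF.comp measurable_mk3)]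
  rfl

/-- The law of the pruned Galton-Watson tree, given that it is not empty. -/
def prunedLaw (ν : Measure ℝ) : Measure (PlaneTree ℝ) :=
  (gwParts ν).map fun x => (mk3 x).pruneTotal

instance (ν : Measure ℝ) [IsProbabilityMeasure ν] : IsProbabilityMeasure (prunedLaw ν) :=
  Measure.isProbabilityMeasure_map (measurable_pruneTotal.comp measurable_mk3).aemeasurable

/-- The decomposition of the pruned tree at the first vertex of the original tree. -/
def pruneStep (ν : Measure ℝ) (X : Measure (PlaneTree ℝ)) : Measure (PlaneTree ℝ) :=
  (4⁻¹ : ℝ≥0∞) • ν.map leaf + (2⁻¹ : ℝ≥0∞) • (ν.prod X).map (fun p => p.2.elongate p.1) +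
    (4⁻¹ : ℝ≥0∞) • (ν.prod (X.prod X)).map mk3

theorem lintegral_pruneStep (ν : Measure ℝ) (X : Measure (PlaneTree ℝ)) [SFinite X]
    {F : PlaneTree ℝ → ℝ≥0∞} (hF : Measurable F) :
    ∫⁻ t, F t ∂pruneStep ν X = 4⁻¹ * ∫⁻ a, F (leaf a) ∂ν +
      2⁻¹ * ∫⁻ a, ∫⁻ t, F (t.elongate a) ∂X ∂ν +
      4⁻¹ * ∫⁻ a, ∫⁻ l, ∫⁻ r, F (node a l r) ∂X ∂X ∂ν := by
  have h1 : Measurable fun p : ℝ × PlaneTree ℝ => F (p.2.elongate p.1) :=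
    hF.comp measurable_elongate
  have h2 : Measurable fun x : ℝ × PlaneTree ℝ × PlaneTree ℝ => F (mk3 x) :=
    hF.comp measurable_mk3
  rw [pruneStep, lintegral_add_measure, lintegral_add_measure, lintegral_smul_measure,
    lintegral_smul_measure, lintegral_smul_measure, lintegral_map hF measurable_leaf,
    lintegral_map hF measurable_elongate, lintegral_map hF measurable_mk3,
    lintegral_prod _ h1.aemeasurable, lintegral_prod _ h2.aemeasurable]
  simp only [smul_eq_mul]
  congr 2
  refine lintegral_congr fun a => ?_
  rw [lintegral_prod (fun x => F (mk3 (a, x))) (h2.comp measurable_prodMk_left).aemeasurable]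
  rfl

theorem four_inv : (2⁻¹ : ℝ≥0∞) * 2⁻¹ = 4⁻¹ := by
  rw [← ENNReal.mul_inv (by norm_num) (by norm_num)]
  norm_num

/-- Each subtree at the first vertex is independently a single edge with probability 1/2, and
otherwise its pruned version has law `prunedLaw ν`. The cases of `join` thus have weights 1/4 (both
empty), 1/2 (exactly one empty) and 1/4 (neither). -/
theorem prunedLaw_eq_pruneStep (ν : Measure ℝ) [IsProbabilityMeasure ν] :
    prunedLaw ν = pruneStep ν (prunedLaw ν) := by
  refine Measure.ext_of_lintegral _ fun F hF => ?_
  have hm : Measurable fun x : ℝ × PlaneTree ℝ × PlaneTree ℝ => (mk3 x).pruneTotal :=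
    measurable_pruneTotal.comp measurable_mk3
  have hpr : ∀ {G : PlaneTree ℝ → ℝ≥0∞}, Measurable G →
      ∫⁻ t, G t ∂prunedLaw ν = ∫⁻ x, G (mk3 x).pruneTotal ∂gwParts ν := fun hG =>
    lintegral_map hG hm
  have hg : Measurable fun x : ℝ × PlaneTree ℝ × PlaneTree ℝ => F (mk3 x).pruneTotal := hF.comp hm
  have hN : ∀ {a : ℝ}, Measurable fun p : PlaneTree ℝ × PlaneTree ℝ => F (node a p.1 p.2) :=
    fun {a} => hF.comp (measurable_const.node measurable_fst measurable_snd)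
  have hE : Measurable fun p : ℝ × PlaneTree ℝ => F (p.2.elongate p.1) :=
    hF.comp measurable_elongate
  have hNN : Measurable fun a => ∫⁻ l, ∫⁻ r, F (node a l r) ∂prunedLaw ν ∂prunedLaw ν := by
    have : Measurable fun p : (ℝ × PlaneTree ℝ) × PlaneTree ℝ => F (node p.1.1 p.1.2 p.2) :=
      hF.comp (Measurable.node (by fun_prop) (by fun_prop) (by fun_prop))
    exact this.lintegral_prod_right'.lintegral_prod_right'
  have hEE : ∀ a, Measurable fun t : PlaneTree ℝ => F (t.elongate a) := fun a =>
    hE.comp measurable_prodMk_left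
  rw [lintegral_pruneStep ν _ hF, hpr hF, lintegral_gwParts ν hg]
  have key : ∀ a, ∫⁻ l, ∫⁻ r, F (mk3 (a, l, r)).pruneTotal ∂gw ν ∂gw ν =
      4⁻¹ * F (leaf a) + 2⁻¹ * ∫⁻ t, F (t.elongate a) ∂prunedLaw ν +
      4⁻¹ * ∫⁻ l, ∫⁻ r, F (node a l r) ∂prunedLaw ν ∂prunedLaw ν := by
    intro a
    have hga : Measurable fun p : PlaneTree ℝ × PlaneTree ℝ => F (mk3 (a, p)).pruneTotal :=
      hg.comp measurable_prodMk_left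
    rw [lintegral_gw_parts ν hga.lintegral_prod_right']
    have e1 : ∀ b, ∫⁻ r, F (mk3 (a, leaf b, r)).pruneTotal ∂gw ν =
        2⁻¹ * F (leaf a) + 2⁻¹ * ∫⁻ t, F (t.elongate a) ∂prunedLaw ν := by
      intro b
      rw [lintegral_gw_parts ν (F := fun r => F (mk3 (a, leaf b, r)).pruneTotal)
        (hga.comp measurable_prodMk_left), hpr (hEE a)]
      simp only [mk3, pruneTotal, isLeaf_leaf, not_isLeaf_node, if_true, if_false,
        lintegral_const, measure_univ, mul_one]
    have e2 : ∀ x, ∫⁻ r, F (mk3 (a, mk3 x, r)).pruneTotal ∂gw ν =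
        2⁻¹ * F ((mk3 x).pruneTotal.elongate a) +
          2⁻¹ * ∫⁻ r, F (node a (mk3 x).pruneTotal r) ∂prunedLaw ν := by
      intro x
      rw [lintegral_gw_parts ν (F := fun r => F (mk3 (a, mk3 x, r)).pruneTotal)
        (hga.comp measurable_prodMk_left), hpr (G := fun r => F (node a (mk3 x).pruneTotal r))
          (hN.comp measurable_prodMk_left)]
      have h3 : ∀ b, (mk3 (a, mk3 x, leaf b)).pruneTotal = (mk3 x).pruneTotal.elongate a := by
        intro b
        rfl
      have h4 : ∀ y, (mk3 (a, mk3 x, mk3 y)).pruneTotal =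
          node a (mk3 x).pruneTotal (mk3 y).pruneTotal := by
        intro y
        rfl
      simp only [h3, h4, lintegral_const, measure_univ, mul_one]
    simp_rw [e1, e2]
    have m1 : Measurable fun x : ℝ × PlaneTree ℝ × PlaneTree ℝ =>
        F ((mk3 x).pruneTotal.elongate a) := (hEE a).comp hm
    have m2 : Measurable fun t => ∫⁻ r, F (node a t r) ∂prunedLaw ν :=
      hN.lintegral_prod_right'
    have m3 : Measurable fun x : ℝ × PlaneTree ℝ × PlaneTree ℝ =>
        ∫⁻ r, F (node a (mk3 x).pruneTotal r) ∂prunedLaw ν := m2.comp hm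
    rw [lintegral_const, measure_univ, mul_one, lintegral_add_left (m1.const_mul _),
      lintegral_const_mul _ m1, lintegral_const_mul _ m3, ← hpr (hEE a), ← hpr m2,
      mul_add, mul_add, ← mul_assoc, ← mul_assoc, ← mul_assoc, four_inv]
    -- The elongation term occurs with weight 1/4 from each side.
    have h5 : (2⁻¹ : ℝ≥0∞) = 4⁻¹ + 4⁻¹ := by
      rw [← four_inv, ← mul_add, ENNReal.inv_two_add_inv_two, mul_one]
    rw [h5]
    ring
  simp_rw [key]
  have hL : Measurable fun a => F (leaf a) := hF.comp measurable_leaf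
  rw [lintegral_add_right _ (hNN.const_mul _), lintegral_add_left (hL.const_mul _),
    lintegral_const_mul _ hNN, lintegral_const_mul _ hE.lintegral_prod_right',
    lintegral_const_mul _ hL]

/-- An exp(γ) root edge is, with probability 1/2, an exp(2γ) edge, and otherwise an exp(2γ) edge
followed by an independent exp(γ) edge. In the second case what follows the first piece is a fresh
copy of the whole tree, hence the elongation term. -/
theorem gw_eq_pruneStep {γ : ℝ} (hγ : 0 < γ) :
    gw (expMeasure γ) = pruneStep (expMeasure (2 * γ)) (gw (expMeasure γ)) := by
  have h1 := isProbabilityMeasure_expMeasure hγ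
  have h2 := isProbabilityMeasure_expMeasure (show 0 < 2 * γ by positivity)
  set ν := expMeasure (2 * γ) with hν
  set ν' := expMeasure γ with hν'
  set κ := gw ν' with hκ
  refine Measure.ext_of_lintegral _ fun F hF => ?_
  have hA : Measurable fun a => F (leaf a) := hF.comp measurable_leaf
  have hB : Measurable fun a => ∫⁻ l, ∫⁻ r, F (node a l r) ∂κ ∂κ := by
    have : Measurable fun p : (ℝ × PlaneTree ℝ) × PlaneTree ℝ => F (node p.1.1 p.1.2 p.2) :=
      hF.comp (Measurable.node (by fun_prop) (by fun_prop) (by fun_prop))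
    exact this.lintegral_prod_right'.lintegral_prod_right'
  have hE : Measurable fun p : ℝ × PlaneTree ℝ => F (p.2.elongate p.1) :=
    hF.comp measurable_elongate
  have hAa : Measurable fun p : ℝ × ℝ => F (leaf (p.1 + p.2)) :=
    hA.comp (measurable_fst.add measurable_snd)
  have hBa : Measurable fun p : ℝ × ℝ => ∫⁻ l, ∫⁻ r, F (node (p.1 + p.2) l r) ∂κ ∂κ :=
    hB.comp (measurable_fst.add measurable_snd)
  have e : ∀ a, ∫⁻ t, F (t.elongate a) ∂κ = 2⁻¹ * ∫⁻ b, F (leaf (a + b)) ∂ν' +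
      2⁻¹ * ∫⁻ b, ∫⁻ l, ∫⁻ r, F (node (a + b) l r) ∂κ ∂κ ∂ν' := fun a =>
    lintegral_gw ν' (F := fun t => F (t.elongate a)) (hE.comp measurable_prodMk_left)
  rw [lintegral_pruneStep ν κ hF]
  simp_rw [e]
  rw [lintegral_add_left (hAa.lintegral_prod_right'.const_mul _),
    lintegral_const_mul _ hAa.lintegral_prod_right',
    lintegral_const_mul _ hBa.lintegral_prod_right', lintegral_gw ν' hF, ← hκ,
    lintegral_expMeasure_half hγ hA, lintegral_expMeasure_half hγ hB, ← four_inv]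
  ring

theorem pruneStep_mono (ν : Measure ℝ) {X Y : Measure (PlaneTree ℝ)} [SFinite Y] (h : X ≤ Y) :
    pruneStep ν X ≤ pruneStep ν Y := by
  have h1 : ν.prod X ≤ ν.prod Y := Measure.prod_mono le_rfl h
  have h2 : ν.prod (X.prod X) ≤ ν.prod (Y.prod Y) :=
    Measure.prod_mono le_rfl (Measure.prod_mono h h)
  unfold pruneStep
  gcongr
  · exact measurable_elongate
  · exact measurable_mk3

theorem pruneStep_univ (ν : Measure ℝ) [IsProbabilityMeasure ν] (X : Measure (PlaneTree ℝ))
    [SFinite X] : pruneStep ν X Set.univ =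
      4⁻¹ + 2⁻¹ * X Set.univ + 4⁻¹ * (X Set.univ * X Set.univ) := by
  have := lintegral_pruneStep ν X (F := fun _ => 1) measurable_const
  simpa using this

/-- The law of the pruned tree is determined by its decomposition. -/
theorem eq_of_eq_pruneStep (ν : Measure ℝ) [IsProbabilityMeasure ν] {X Y : Measure (PlaneTree ℝ)}
    [IsProbabilityMeasure X] [IsProbabilityMeasure Y] (hX : X = pruneStep ν X)
    (hY : Y = pruneStep ν Y) : X = Y := by
  -- By monotonicity the iterates started from the zero measure stay below every fixed point. Once
  -- their mass tends to 1, there is room for only one fixed probability law.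
  let Z : ℕ → Measure (PlaneTree ℝ) := fun n => (pruneStep ν)^[n] 0
  have hs : ∀ n, Z (n + 1) = pruneStep ν (Z n) := fun n =>
    Function.iterate_succ_apply' _ _ _
  have hle : ∀ {X : Measure (PlaneTree ℝ)} [IsProbabilityMeasure X], X = pruneStep ν X →
      ∀ n, Z n ≤ X := by
    intro X _ hX n
    induction n with
    | zero => exact Measure.zero_le _
    | succ n ih =>
      rw [hs, hX]
      exact pruneStep_mono ν ih
  have hfin : ∀ n, IsFiniteMeasure (Z n) := fun n => isFiniteMeasure_of_le X (hle hX n)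
  -- The missing mass evolves by d ↦ d − d²/4, which is increasing on [0, 1] and maps 4/(n + 4)
  -- below 4/(n + 5), since (n + 3)(n + 5) ≤ (n + 4)².
  have hmass : ∀ n : ℕ, 1 - (Z n).real Set.univ ≤ 4 / (n + 4) := by
    intro n
    induction n with
    | zero => simp [Z]
    | succ n ih =>
      have h1 : (Z n).real Set.univ ≤ 1 := by
        refine ENNReal.toReal_le_of_le_ofReal zero_le_one ?_
        rw [ENNReal.ofReal_one]
        exact (hle hX n Set.univ).trans_eq measure_univ
      have h2 : (Z (n + 1)).real Set.univ = 1 / 4 + 1 / 2 * (Z n).real Set.univ +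
          1 / 4 * ((Z n).real Set.univ * (Z n).real Set.univ) := by
        rw [hs, measureReal_def, pruneStep_univ, ENNReal.toReal_add, ENNReal.toReal_add]
        · simp [ENNReal.toReal_mul, measureReal_def]
        · simp
        · finiteness
        · finiteness
        · finiteness
      set d := 1 - (Z n).real Set.univ with hd
      have h0 : 0 ≤ d := by linarith
      have h3 : 1 - (Z (n + 1)).real Set.univ = d - d ^ 2 / 4 := by rw [h2, hd]; ring
      rw [h3]
      set q : ℝ := 4 / (n + 4) with hq
      have hn : (0 : ℝ) ≤ n := n.cast_nonneg
      have hq1 : q ≤ 1 := by rw [hq, div_le_one (by positivity)]; linarith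
      have h4 : d - d ^ 2 / 4 ≤ q - q ^ 2 / 4 := by nlinarith
      refine h4.trans ?_
      rw [hq, Nat.cast_succ, div_pow, div_div, div_sub_div _ _ (by positivity) (by positivity),
        div_le_div_iff₀ (by positivity) (by positivity)]
      nlinarith [pow_nonneg hn 2, pow_nonneg hn 3]
  have hcmp : ∀ {X Y : Measure (PlaneTree ℝ)} [IsProbabilityMeasure X] [IsProbabilityMeasure Y],
      X = pruneStep ν X → Y = pruneStep ν Y → ∀ A, MeasurableSet A → X.real A ≤ Y.real A := by
    intro X Y _ _ hX hY A hA
    -- Passing to complements, X(A) ≤ 1 − Z_n(Aᶜ), which is Z_n(A) plus the missing mass, and Z_n(A)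
    -- ≤ Y(A).
    have hb : ∀ n : ℕ, X.real A ≤ Y.real A + 4 / (n + 4) := by
      intro n
      have h1 : (Z n).real Aᶜ ≤ X.real Aᶜ :=
        ENNReal.toReal_mono (measure_ne_top _ _) (hle hX n _)
      have h2 : (Z n).real A ≤ Y.real A := ENNReal.toReal_mono (measure_ne_top _ _) (hle hY n _)
      have h3 := measureReal_add_measureReal_compl (μ := X) hA
      have h4 := measureReal_add_measureReal_compl (μ := Z n) hA
      have h5 : X.real Set.univ = 1 := by simp
      linarith [hmass n]
    have h6 : Filter.Tendsto (fun n : ℕ => (4 : ℝ) / ((n : ℝ) + 4)) Filter.atTop (nhds 0) :=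
      Filter.Tendsto.const_div_atTop
        (Filter.tendsto_atTop_add_const_right _ _ tendsto_natCast_atTop_atTop) _
    have h7 := h6.const_add (Y.real A)
    rw [add_zero] at h7
    exact ge_of_tendsto' h7 hb
  ext A hA
  rw [← measureReal_eq_measureReal_iff]
  exact le_antisymm (hcmp hX hY A hA) (hcmp hY hX A hA)

theorem prunedLaw_exp {γ : ℝ} (hγ : 0 < γ) :
    prunedLaw (expMeasure (2 * γ)) = gw (expMeasure γ) := by
  have h1 := isProbabilityMeasure_expMeasure hγ
  have h2 := isProbabilityMeasure_expMeasure (show 0 < 2 * γ by positivity)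
  exact eq_of_eq_pruneStep _ (prunedLaw_eq_pruneStep _) (gw_eq_pruneStep hγ)

theorem iidLengths_map (ν : Measure ℝ) [IsProbabilityMeasure ν] {f : ℝ → ℝ} (hf : Measurable f)
    (s : PlaneTree Unit) :
    iidLengths (ν.map f) s = (iidLengths ν s).map (PlaneTree.map f) := by
  have hm := measurable_map hf
  induction s with
  | leaf a =>
    rw [iidLengths, iidLengths, Measure.map_map measurable_leaf hf,
      Measure.map_map hm measurable_leaf]
    rfl
  | node a l r ihl ihr =>
    have h3 : Measurable fun x : ℝ × PlaneTree ℝ × PlaneTree ℝ => node x.1 x.2.1 x.2.2 :=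
      measurable_mk3
    rw [iidLengths, iidLengths, ihl, ihr, Measure.map_prod_map _ _ hm hm,
      Measure.map_prod_map _ _ hf (hm.prodMap hm),
      Measure.map_map h3 (hf.prodMap (hm.prodMap hm)), Measure.map_map hm h3]
    rfl

theorem gw_map (ν : Measure ℝ) [IsProbabilityMeasure ν] {f : ℝ → ℝ} (hf : Measurable f) :
    gw (ν.map f) = (gw ν).map (PlaneTree.map f) := by
  rw [gw, gw, Measure.map_sum (measurable_map hf).aemeasurable]
  congr 1
  ext1 s
  rw [iidLengths_map ν hf, Measure.map_smul]

/-- Pruning a critical exponential Galton-Watson tree doubles its edge lengths. -/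
theorem prunedLaw_eq_map {γ : ℝ} (hγ : 0 < γ) :
    prunedLaw (expMeasure (2 * γ)) =
      (gw (expMeasure (2 * γ))).map (PlaneTree.map fun x => 2 * x) := by
  have h2 := isProbabilityMeasure_expMeasure (show 0 < 2 * γ by positivity)
  rw [prunedLaw_exp hγ, ← map_two_mul_expMeasure hγ, gw_map _ (by fun_prop)]

/-! ### Shapes, scaling and pruning without the embedding -/

section Forget

variable {γ : ℝ}

theorem measurable_shape : Measurable NTree.shape := by
  intro A hA
  have : Measurable fun t : PlaneTree ℝ => (t.map fun _ => ()).forget :=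
    measurable_forget.comp (measurable_map measurable_const)
  exact this hA

theorem measurableSet_shape_eq (τ : Shape) : MeasurableSet {T : LTree | T.shape = τ} := by
  refine measurable_shape (t := {τ}) ?_
  exact (Set.to_countable (forget ⁻¹' {τ})).measurableSet

theorem measurable_scale (c : ℝ) : Measurable (NTree.scale c) := by
  intro A hA
  have : Measurable fun t : PlaneTree ℝ => (t.map fun x => c * x).forget :=
    measurable_forget.comp (measurable_map (by fun_prop))
  exact this hA

theorem shape_scale (c : ℝ) (T : LTree) : (T.scale c).shape = T.shape := by
  induction T using Quot.inductionOn with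
  | _ t => exact congrArg forget (map_map (fun x : ℝ => c * x) (fun _ => ()) t)

theorem preimage_prune_mem (A : Set LTree) :
    forget ⁻¹' {T : LTree | ∃ T' ∈ T.prune, T' ∈ A} =
      mk3 '' ((fun x => (mk3 x).pruneTotal.forget) ⁻¹' A) := by
  ext t
  change (∃ T' ∈ t.prune.map forget, T' ∈ A) ↔ _
  rw [prune_eq]
  cases t with
  | leaf a => simp [mk3]
  | node a l r =>
    rw [if_neg (not_isLeaf_node a l r)]
    simp [mk3]

theorem measurableSet_prune_mem {A : Set LTree} (hA : MeasurableSet A) :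
    MeasurableSet {T : LTree | ∃ T' ∈ T.prune, T' ∈ A} := by
  rw [measurableSet_ntree, preimage_prune_mem]
  exact measurableSet_image_mk3
    ((measurable_forget.comp (measurable_pruneTotal.comp measurable_mk3)) hA)

theorem gw_image_mk3 (ν : Measure ℝ) [IsProbabilityMeasure ν]
    {C : Set (ℝ × PlaneTree ℝ × PlaneTree ℝ)} (hC : MeasurableSet C) :
    gw ν (mk3 '' C) = 2⁻¹ * gwParts ν C := by
  have hm := measurableSet_image_mk3 hC
  rw [gw_eq, Measure.add_apply, Measure.smul_apply, Measure.smul_apply,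
    Measure.map_apply measurable_leaf hm, Measure.map_apply measurable_mk3 hm,
    Set.preimage_image_eq _ mk3_injective]
  have : leaf ⁻¹' (mk3 '' C) = (∅ : Set ℝ) := by
    ext a
    simp [mk3]
  rw [this, measure_empty, smul_zero, zero_add]
  rfl

/-- The factor 1/2 is the probability that the tree is not a single edge, hence survives pruning;
given survival, pruning acts in law as doubling all lengths. -/
theorem map_forget_prune_mem (hγ : 0 < γ) {A : Set LTree} (hA : MeasurableSet A) :
    (gw (expMeasure (2 * γ))).map forget {T : LTree | ∃ T' ∈ T.prune, T' ∈ A} =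
      2⁻¹ * (gw (expMeasure (2 * γ))).map forget {T : LTree | T.scale 2 ∈ A} := by
  have h2 := isProbabilityMeasure_expMeasure (show 0 < 2 * γ by positivity)
  have hm : Measurable fun x : ℝ × PlaneTree ℝ × PlaneTree ℝ => (mk3 x).pruneTotal :=
    measurable_pruneTotal.comp measurable_mk3
  rw [Measure.map_apply measurable_forget (measurableSet_prune_mem hA), preimage_prune_mem,
    gw_image_mk3 _ (C := (fun x => (mk3 x).pruneTotal.forget) ⁻¹' A)
      ((measurable_forget.comp hm) hA),
    Measure.map_apply (s := {T : LTree | T.scale 2 ∈ A}) measurable_forget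
      (measurable_scale 2 hA)]
  have h3 := congrArg (fun μ => μ (forget ⁻¹' A)) (prunedLaw_eq_map hγ)
  simp only [prunedLaw] at h3
  rw [Measure.map_apply hm (measurable_forget hA), Measure.map_apply
    (measurable_map (by fun_prop)) (measurable_forget hA)] at h3
  congr 1

end Forget

/-! ### Counting the complete subtrees of a given order -/

theorem max_le_mergeOrder (i j : ℕ) : max i j ≤ mergeOrder i j := Nat.le_add_right _ _

theorem mergeOrder_le (i j : ℕ) : mergeOrder i j ≤ max i j + 1 := by
  unfold mergeOrder
  split_ifs <;> omega

namespace PlaneTree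

variable {α : Type} {K : ℕ}

/-- Orders do not increase away from the root. Below a root of order at most K, the parent of a
subtree of order K has order K itself, so no branch of order K starts there. -/
theorem properComplete_of_order_le {t : PlaneTree α} (h : t.order ≤ K) :
    t.properComplete K = 0 := by
  induction t with
  | leaf a => rfl
  | node a l r ihl ihr =>
    have h1 := max_le_mergeOrder l.order r.order
    rw [order_node] at h
    rw [properComplete, ihl (by omega), ihr (by omega), order_node, if_neg (by omega),
      if_neg (by omega)]
    rfl

theorem complete_of_order_eq {t : PlaneTree α} (h : t.order = K) : t.complete K = {t} := by
  rw [complete, if_pos h, properComplete_of_order_le h.le, add_zero]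

theorem complete_of_order_lt {t : PlaneTree α} (h : t.order < K) : t.complete K = 0 := by
  rw [complete, if_neg h.ne, properComplete_of_order_le h.le, add_zero]

theorem complete_node {a : α} {l r : PlaneTree α} (h : K < (node a l r).order) :
    (node a l r).complete K = l.complete K + r.complete K := by
  rw [complete, if_neg h.ne', properComplete, complete, complete]
  simp only [h.ne', ne_eq, not_false_eq_true, and_true, zero_add]
  abel

/-- The number of complete subtrees of order `K`. -/
def completeCard (K : ℕ) (t : PlaneTree α) : ℕ := (t.complete K).card

theorem completeCard_node (a : α) (l r : PlaneTree α) : (node a l r).completeCard K =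
    if (node a l r).order = K then 1
    else if K < (node a l r).order then l.completeCard K + r.completeCard K else 0 := by
  unfold completeCard
  rcases lt_trichotomy (node a l r).order K with h | h | h
  · rw [complete_of_order_lt h, if_neg h.ne, if_neg h.not_gt]
    rfl
  · rw [complete_of_order_eq h, if_pos h]
    rfl
  · rw [complete_node h, if_neg h.ne', if_pos h, Multiset.card_add]

theorem completeCard_leaf (a : α) : (leaf a).completeCard K = if 1 = K then 1 else 0 := by
  by_cases h : 1 = K
  · rw [completeCard, complete_of_order_eq (show (leaf a).order = K from h), if_pos h]
    rfl
  · rw [completeCard, complete, if_neg (show ¬ (leaf a).order = K from h), if_neg h]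
    rfl

/-- Along children of maximal order the order drops by at most one per step, so starting at or above
K it meets K. -/
theorem completeCard_ne_zero (hK : 1 ≤ K) {t : PlaneTree α} (h : K ≤ t.order) :
    t.completeCard K ≠ 0 := by
  induction t with
  | leaf a =>
    have h : K ≤ 1 := h
    rw [completeCard_leaf, if_pos (by omega)]
    exact one_ne_zero
  | node a l r ihl ihr =>
    rw [completeCard_node]
    split_ifs with h1 h2
    · exact one_ne_zero
    · rw [order_node] at h2
      have h3 := mergeOrder_le l.order r.order
      rcases le_total r.order l.order with h4 | h4
      · have := ihl (by omega)
        omega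
      · have := ihr (by omega)
        omega
    · omega

theorem measurable_completeCard [MeasurableSpace α] (K : ℕ) :
    Measurable (completeCard K : PlaneTree α → ℕ) := by
  refine measurable_of_rec (fun _ => if 1 = K then 1 else 0)
    (fun a l r i j => if (node a l r).order = K then 1
      else if K < (node a l r).order then i + j else 0) measurable_const ?_
    completeCard_leaf completeCard_node
  have ho : Measurable fun x : α × PlaneTree α × PlaneTree α × ℕ × ℕ =>
      (node x.1 x.2.1 x.2.2.1).order :=
    measurable_order.comp (Measurable.node (by fun_prop) (by fun_prop) (by fun_prop))
  exact Measurable.ite (ho (measurableSet_singleton K)) measurable_const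
    (Measurable.ite (measurableSet_lt measurable_const ho) (by fun_prop) measurable_const)

open Classical in
/-- The number of the complete subtrees of order `K` at level `n` that belong to `B`. -/
def levelCount (K : ℕ) (B : Set (PlaneTree α)) : ℕ → PlaneTree α → ℝ≥0∞
  | 0, t => if t.order = K ∧ t ∈ B then 1 else 0
  | _ + 1, leaf _ => 0
  | n + 1, node a l r =>
    if K < (node a l r).order then levelCount K B n l + levelCount K B n r else 0

theorem measurable_levelCount [MeasurableSpace α] (K : ℕ) {B : Set (PlaneTree α)}
    (hB : MeasurableSet B) (n : ℕ) : Measurable (levelCount K B n) := by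
  induction n with
  | zero =>
    exact Measurable.ite ((measurable_order (measurableSet_singleton K)).inter hB)
      measurable_const measurable_const
  | succ n ih =>
    refine measurable_of_cases measurable_const ?_
    exact Measurable.ite (measurableSet_lt measurable_const
      (measurable_order.comp measurable_mk3)) ((ih.comp (measurable_fst.comp measurable_snd)).add
      (ih.comp (measurable_snd.comp measurable_snd))) measurable_const

-- Splitting the count by generation gives terms that obey a one-step recursion, to which the
-- branching property applies.
open Classical in
theorem countP_complete_eq_tsum (K : ℕ) (B : Set (PlaneTree α)) (t : PlaneTree α) :
    ((t.complete K).countP (· ∈ B) : ℝ≥0∞) = ∑' n, levelCount K B n t := by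
  have hlow : ∀ {t : PlaneTree α}, ¬ K < t.order → ∀ n, levelCount K B (n + 1) t = 0 := by
    intro t ht n
    cases t with
    | leaf a => rfl
    | node a l r => rw [levelCount, if_neg ht]
  have hbase : ∀ {t : PlaneTree α}, ¬ K < t.order →
      ((t.complete K).countP (· ∈ B) : ℝ≥0∞) = ∑' n, levelCount K B n t := by
    intro t ht
    rw [tsum_eq_zero_add' ENNReal.summable]
    simp_rw [hlow ht]
    rw [tsum_zero, add_zero, levelCount]
    rcases (not_lt.1 ht).lt_or_eq with h | h
    · rw [complete_of_order_lt h, if_neg (by omega)]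
      simp
    · rw [complete_of_order_eq h]
      by_cases hB : t ∈ B <;> simp [h, hB, Multiset.countP_eq_card_filter, Multiset.filter_singleton]
  induction t with
  | leaf a =>
    by_cases h : K < (leaf a).order
    · rw [complete, if_neg h.ne', properComplete, tsum_eq_zero_add' ENNReal.summable]
      simp [levelCount, h.ne']
    · exact hbase h
  | node a l r ihl ihr =>
    by_cases h : K < (node a l r).order
    · rw [complete_node h, Multiset.countP_add, Nat.cast_add, ihl, ihr,
        tsum_eq_zero_add' (f := fun n => levelCount K B n (node a l r)) ENNReal.summable, ← ENNReal.tsum_add]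
      simp only [levelCount, if_pos h]
      rw [if_neg (by omega), zero_add]
    · exact hbase h

end PlaneTree

/-! ### Coordination of the Galton–Watson law -/

section Coordination

variable (ν : Measure ℝ) [IsProbabilityMeasure ν] (K : ℕ)

/-- Integrating out the sibling of the initial vertex of the selected subtree. -/
def siblingMean (f : ℕ → ℕ → ℝ≥0∞) (h m : ℕ) : ℝ≥0∞ :=
  ∫⁻ r, (if K < mergeOrder h r.order then
    f (mergeOrder h r.order) (m + r.completeCard K) else 0) ∂gw ν

variable {K}

/-- The selected subtree lies left or right of the first vertex with equal contributions, which
cancels the splitting probability 1/2. The sibling is independent and enters only through its order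
and count, so integrating it out leaves a new test function of the same kind. -/
theorem lintegral_levelCount_succ {B : Set (PlaneTree ℝ)} (hB : MeasurableSet B) (n : ℕ)
    (f : ℕ → ℕ → ℝ≥0∞) :
    ∫⁻ t, levelCount K B (n + 1) t * f t.order (t.completeCard K) ∂gw ν =
      ∫⁻ t, levelCount K B n t * siblingMean ν K f t.order (t.completeCard K) ∂gw ν := by
  have ho : Measurable (order : PlaneTree ℝ → ℕ) := measurable_order
  have hc : Measurable (completeCard K : PlaneTree ℝ → ℕ) := measurable_completeCard K
  have hl := measurable_levelCount K hB n
  have hf : Measurable fun t : PlaneTree ℝ => f t.order (t.completeCard K) :=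
    (measurable_of_countable fun p : ℕ × ℕ => f p.1 p.2).comp (ho.prodMk hc)
  let g : PlaneTree ℝ → PlaneTree ℝ → ℝ≥0∞ := fun l r =>
    if K < mergeOrder l.order r.order then
      f (mergeOrder l.order r.order) (l.completeCard K + r.completeCard K) else 0
  have hg : Measurable fun p : PlaneTree ℝ × PlaneTree ℝ => g p.1 p.2 :=
    (measurable_of_countable fun q : (ℕ × ℕ) × ℕ × ℕ =>
      if K < mergeOrder q.1.1 q.2.1 then f (mergeOrder q.1.1 q.2.1) (q.1.2 + q.2.2) else 0).comp
      (((ho.prodMk hc).comp measurable_fst).prodMk ((ho.prodMk hc).comp measurable_snd))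
  have hgs : ∀ l r, g l r = g r l := fun l r => by
    simp only [g, mergeOrder_comm l.order, add_comm (l.completeCard K)]
  rw [lintegral_gw ν (F := fun t => levelCount K B (n + 1) t * f t.order (t.completeCard K))
    ((measurable_levelCount K hB (n + 1)).mul hf)]
  have e1 : ∀ a : ℝ, levelCount K B (n + 1) (leaf a) = 0 := fun a => rfl
  have e2 : ∀ a l r, levelCount K B (n + 1) (node a l r) *
      f (node a l r).order ((node a l r).completeCard K) =
      levelCount K B n l * g l r + levelCount K B n r * g r l := by
    intro a l r
    rw [hgs r l, ← add_mul, completeCard_node]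
    simp only [levelCount, g, order_node]
    by_cases h : K < mergeOrder l.order r.order
    · simp [h, h.ne']
    · simp [h]
  have m1 : Measurable fun p : PlaneTree ℝ × PlaneTree ℝ => levelCount K B n p.1 * g p.1 p.2 :=
    (hl.comp measurable_fst).mul hg
  have m2 : Measurable fun p : PlaneTree ℝ × PlaneTree ℝ => levelCount K B n p.2 * g p.2 p.1 :=
    m1.comp measurable_swap
  have e3 : ∀ l, ∫⁻ r, (levelCount K B n l * g l r + levelCount K B n r * g r l) ∂gw ν =
      ∫⁻ r, levelCount K B n l * g l r ∂gw ν + ∫⁻ r, levelCount K B n r * g r l ∂gw ν :=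
    fun l => lintegral_add_left (m1.comp measurable_prodMk_left) _
  simp_rw [e1, e2, zero_mul, e3]
  rw [lintegral_add_left m1.lintegral_prod_right', lintegral_lintegral_swap
    (f := fun l r => levelCount K B n r * g r l) m2.aemeasurable]
  simp only [lintegral_const, measure_univ, mul_one, mul_zero, zero_add]
  rw [← two_mul, ← mul_assoc, ENNReal.inv_mul_cancel (by norm_num) (by norm_num), one_mul]
  exact lintegral_congr fun l => lintegral_const_mul _ (hg.comp measurable_prodMk_left)

/-- At level 0 the selected subtree is the whole tree, whose order K and count 1 are fixed, so the
test function factors out as `f K 1`. Each further level replaces `f` by `siblingMean`,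
independently of `B`. -/
theorem lintegral_levelCount {B : Set (PlaneTree ℝ)} (hB : MeasurableSet B) (n : ℕ)
    (f : ℕ → ℕ → ℝ≥0∞) :
    gw ν {t | t.order = K} * ∫⁻ t, levelCount K B n t * f t.order (t.completeCard K) ∂gw ν =
      gw ν ({t | t.order = K} ∩ B) *
        ∫⁻ t, levelCount K Set.univ n t * f t.order (t.completeCard K) ∂gw ν := by
  classical
  induction n generalizing f with
  | zero =>
    have h : ∀ {B : Set (PlaneTree ℝ)}, MeasurableSet B →
        ∫⁻ t, levelCount K B 0 t * f t.order (t.completeCard K) ∂gw ν =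
          f K 1 * gw ν ({t | t.order = K} ∩ B) := by
      intro B hB
      have hm : MeasurableSet ({t : PlaneTree ℝ | t.order = K} ∩ B) :=
        (measurable_order (measurableSet_singleton K)).inter hB
      rw [← lintegral_indicator_const hm]
      refine lintegral_congr fun t => ?_
      rw [levelCount]
      by_cases h : t.order = K ∧ t ∈ B
      · rw [if_pos h, Set.indicator_of_mem (by exact h), one_mul, h.1, completeCard,
          complete_of_order_eq h.1, Multiset.card_singleton]
      · rw [if_neg h, Set.indicator_of_notMem (by exact h), zero_mul]
    rw [h hB, h MeasurableSet.univ, Set.inter_univ]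
    ring
  | succ n ih =>
    rw [lintegral_levelCount_succ ν hB, lintegral_levelCount_succ ν MeasurableSet.univ, ih]

open Classical in
/-- The complete subtrees of order `K` have, on average over the tree, the law of the tree given
order `K`, whatever the order of the tree and the number of these subtrees. -/
theorem lintegral_countP_complete {B : Set (PlaneTree ℝ)} (hB : MeasurableSet B)
    (f : ℕ → ℕ → ℝ≥0∞) :
    gw ν {t | t.order = K} * ∫⁻ t, ((t.complete K).countP (· ∈ B) : ℝ≥0∞) *
        f t.order (t.completeCard K) ∂gw ν =
      gw ν ({t | t.order = K} ∩ B) *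
        ∫⁻ t, (t.completeCard K : ℝ≥0∞) * f t.order (t.completeCard K) ∂gw ν := by
  have hf : Measurable fun t : PlaneTree ℝ => f t.order (t.completeCard K) :=
    (measurable_of_countable fun p : ℕ × ℕ => f p.1 p.2).comp
      (measurable_order.prodMk (measurable_completeCard K))
  have hs : ∀ {B : Set (PlaneTree ℝ)}, MeasurableSet B →
      ∫⁻ t, ((t.complete K).countP (· ∈ B) : ℝ≥0∞) * f t.order (t.completeCard K) ∂gw ν =
        ∑' n, ∫⁻ t, levelCount K B n t * f t.order (t.completeCard K) ∂gw ν := by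
    intro B hB
    simp_rw [countP_complete_eq_tsum, ← ENNReal.tsum_mul_right]
    exact lintegral_tsum fun n => ((measurable_levelCount K hB n).mul hf).aemeasurable
  have hu : ∫⁻ t, (t.completeCard K : ℝ≥0∞) * f t.order (t.completeCard K) ∂gw ν =
      ∑' n, ∫⁻ t, levelCount K Set.univ n t * f t.order (t.completeCard K) ∂gw ν := by
    rw [← hs MeasurableSet.univ]
    refine lintegral_congr fun t => ?_
    congr 2
    simp [completeCard]
  rw [hs hB, hu, ← ENNReal.tsum_mul_left, ← ENNReal.tsum_mul_left]
  exact tsum_congr fun n => lintegral_levelCount ν hB n f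

theorem gw_order_ne_zero (hK : 1 ≤ K) : gw ν {t | t.order = K} ≠ 0 := by
  induction K, hK using Nat.le_induction with
  | base =>
    have h := measurable_order (α := ℝ) (measurableSet_singleton 1)
    have hsub : gw ν {t | t.order = 1} ≥ 2⁻¹ := by
      change gw ν (order ⁻¹' {1}) ≥ 2⁻¹
      rw [gw_eq, Measure.add_apply, Measure.smul_apply, Measure.map_apply measurable_leaf h]
      have : leaf ⁻¹' (order ⁻¹' {1}) = (Set.univ : Set ℝ) := Set.eq_univ_of_forall fun a => rfl
      rw [this, measure_univ, smul_eq_mul, mul_one]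
      exact le_self_add
    exact (lt_of_lt_of_le (by simp) hsub).ne'
  | succ K hK ih =>
    have h : MeasurableSet {t : PlaneTree ℝ | t.order = K} :=
      measurable_order (measurableSet_singleton K)
    have hsub : mk3 '' (Set.univ ×ˢ ({t | t.order = K} ×ˢ {t | t.order = K})) ⊆
        {t : PlaneTree ℝ | t.order = K + 1} := by
      rintro _ ⟨⟨a, l, r⟩, ⟨-, hl, hr⟩, rfl⟩
      have hl : l.order = K := hl
      have hr : r.order = K := hr
      change mergeOrder l.order r.order = K + 1
      simp [hl, hr, mergeOrder]
    refine fun h0 => ?_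
    have h1 := measure_mono_null hsub h0
    rw [gw_image_mk3 ν (MeasurableSet.univ.prod (h.prod h)), gwParts, Measure.prod_prod,
      Measure.prod_prod] at h1
    simp [ih] at h1

variable {K : ℕ} {H : ℕ}

theorem measurableSet_order_eq (K : ℕ) : MeasurableSet {T : LTree | T.order = K} :=
  measurable_order (α := ℝ) (measurableSet_singleton K)

theorem subtreeLaw_gw (hK : 1 ≤ K) (hKH : K ≤ H) {A : Set LTree} (hA : MeasurableSet A) :
    subtreeLaw ((gw ν).map forget) K H A = cond ((gw ν).map forget) {T | T.order = K} A := by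
  classical
  set B : Set (PlaneTree ℝ) := forget ⁻¹' A with hB
  have hBm : MeasurableSet B := hA
  have hfrac : ∀ t : PlaneTree ℝ, t.forget.completeFraction K A =
      ((t.complete K).countP (· ∈ B) : ℝ≥0∞) / (t.completeCard K : ℝ≥0∞) := by
    intro t
    change (((t.complete K).map forget).countP (· ∈ A) : ℝ≥0∞) /
      (((t.complete K).map forget).card : ℝ≥0∞) = _
    rw [Multiset.card_map, Multiset.countP_map, Multiset.countP_eq_card_filter]
    rfl
  have hcount : Measurable fun t : PlaneTree ℝ => ((t.complete K).countP (· ∈ B) : ℝ≥0∞) := by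
    simp_rw [countP_complete_eq_tsum]
    exact Measurable.tsum fun n => measurable_levelCount K hBm n
  have hcard : Measurable fun t : PlaneTree ℝ => (t.completeCard K : ℝ≥0∞) :=
    (measurable_of_countable fun n : ℕ => (n : ℝ≥0∞)).comp (measurable_completeCard K)
  have hfm : Measurable fun T : LTree => T.completeFraction K A := by
    have : Measurable fun t : PlaneTree ℝ => t.forget.completeFraction K A := by
      simp_rw [hfrac]
      exact hcount.div hcard
    exact fun s hs => this hs
  have hH : MeasurableSet {t : PlaneTree ℝ | t.order = H} := measurableSet_order_eq H
  have hint : ∫⁻ T in {T : LTree | T.order = H}, T.completeFraction K A ∂(gw ν).map forget =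
      ∫⁻ t, ((t.complete K).countP (· ∈ B) : ℝ≥0∞) *
        (if t.order = H then (t.completeCard K : ℝ≥0∞)⁻¹ else 0) ∂gw ν := by
    rw [← lintegral_indicator (measurableSet_order_eq H),
      lintegral_map (hfm.indicator (measurableSet_order_eq H)) measurable_forget]
    refine lintegral_congr fun t => ?_
    by_cases h : t.order = H
    · rw [Set.indicator_of_mem (by exact h), if_pos h, hfrac, div_eq_mul_inv]
    · rw [Set.indicator_of_notMem (by exact h), if_neg h, mul_zero]
  -- Uniform selection given order H weights each complete subtree by the inverse of their number;
  -- this depends on the order and the number only.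
  have hkey := lintegral_countP_complete ν (K := K) hBm
    fun h m => if h = H then (m : ℝ≥0∞)⁻¹ else 0
  -- The weights add up to one because a tree of order H ≥ K has at least one complete subtree of
  -- order K.
  have hone : ∫⁻ t : PlaneTree ℝ, (t.completeCard K : ℝ≥0∞) *
      (if t.order = H then (t.completeCard K : ℝ≥0∞)⁻¹ else 0) ∂gw ν =
      gw ν {t | t.order = H} := by
    rw [← lintegral_indicator_one hH]
    refine lintegral_congr fun t => ?_
    by_cases h : t.order = H
    · rw [Set.indicator_of_mem (by exact h), if_pos h, ENNReal.mul_inv_cancel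
        (Nat.cast_ne_zero.2 (completeCard_ne_zero hK (by omega))) (ENNReal.natCast_ne_top _)]
      rfl
    · rw [Set.indicator_of_notMem (by exact h), if_neg h, mul_zero]
  rw [hone] at hkey
  have hH0 := gw_order_ne_zero ν (hK.trans hKH)
  have hK0 := gw_order_ne_zero ν hK
  have eo : ∀ J, (gw ν).map forget {T : LTree | T.order = J} = gw ν {t | t.order = J} :=
    fun J => Measure.map_apply measurable_forget (measurableSet_order_eq J)
  have eA : (gw ν).map forget ({T : LTree | T.order = K} ∩ A) =
      gw ν ({t | t.order = K} ∩ B) :=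
    Measure.map_apply measurable_forget ((measurableSet_order_eq K).inter hA)
  rw [subtreeLaw, ProbabilityTheory.cond, lintegral_smul_measure, hint, cond_apply (measurableSet_order_eq K), eo,
    eo, eA, smul_eq_mul]
  generalize ∫⁻ t : PlaneTree ℝ, ((t.complete K).countP (· ∈ B) : ℝ≥0∞) *
    (if t.order = H then (t.completeCard K : ℝ≥0∞)⁻¹ else 0) ∂gw ν = I at hkey ⊢
  have h1 : I = (gw ν {t | t.order = K})⁻¹ *
      (gw ν ({t | t.order = K} ∩ B) * gw ν {t | t.order = H}) := by
    rw [← hkey, ← mul_assoc, ENNReal.inv_mul_cancel hK0 (measure_ne_top _ _), one_mul]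
  rw [h1, mul_comm (gw ν ({t | t.order = K} ∩ B)), mul_left_comm, ← mul_assoc,
    ← mul_assoc, mul_assoc _ _ (gw ν {t | t.order = H}), ENNReal.inv_mul_cancel hH0 (measure_ne_top _ _), mul_one]

end Coordination

/-! ### Self-similarity -/

theorem order_of_shape_eq {T : LTree} {τ : Shape} (h : T.shape = τ) : T.order = τ.order := by
  subst h
  induction T using Quot.inductionOn with
  | _ t => exact (order_map (fun _ => ()) t).symm

theorem isSelfSimilar_gw {γ : ℝ} (hγ : 0 < γ) :
    IsSelfSimilar ((gw (expMeasure (2 * γ))).map forget) 2 := by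
  have hν := isProbabilityMeasure_expMeasure (show 0 < 2 * γ by positivity)
  have hη := Measure.isProbabilityMeasure_map (μ := gw (expMeasure (2 * γ)))
    (measurable_forget (α := ℝ)).aemeasurable
  have hU : {T : LTree | T.prune ≠ none} = {T : LTree | ∃ T' ∈ T.prune, T' ∈ Set.univ} := by
    ext T
    simp [Option.ne_none_iff_exists']
  have hUA : ∀ C A : Set LTree, {T : LTree | ∃ T' ∈ T.prune, T' ∈ C} ∩
      {T : LTree | ∃ T' ∈ T.prune, T' ∈ A} = {T : LTree | ∃ T' ∈ T.prune, T' ∈ C ∩ A} := by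
    intro C A
    ext T
    constructor
    · rintro ⟨⟨T', h1, h2⟩, T'', h3, h4⟩
      obtain rfl := Option.mem_unique h1 h3
      exact ⟨T', h1, h2, h4⟩
    · rintro ⟨T', h1, h2, h3⟩
      exact ⟨⟨T', h1, h2⟩, T', h1, h3⟩
  -- Both prune-invariance conditions are instances of this; the survival probability 1/2 cancels
  -- between numerator and denominator.
  have hcond : ∀ {C A : Set LTree}, MeasurableSet C → MeasurableSet A →
      cond ((gw (expMeasure (2 * γ))).map forget) {T | ∃ T' ∈ T.prune, T' ∈ C}
        {T | ∃ T' ∈ T.prune, T' ∈ A} =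
      cond ((gw (expMeasure (2 * γ))).map forget) {T | T.scale 2 ∈ C} {T | T.scale 2 ∈ A} := by
    intro C A hC hA
    rw [cond_apply (measurableSet_prune_mem hC),
      cond_apply (s := {T : LTree | T.scale 2 ∈ C}) (measurable_scale 2 hC), hUA,
      map_forget_prune_mem hγ hC, map_forget_prune_mem hγ (hC.inter hA),
      ENNReal.mul_inv (by simp) (by simp), inv_inv, mul_mul_mul_comm,
      ENNReal.mul_inv_cancel (by norm_num) (by norm_num), one_mul]
    rfl
  refine ⟨hη, two_pos, ?_, ?_, ?_, ?_⟩
  · intro K H hK hKH τ _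
    exact subtreeLaw_gw _ hK hKH (measurableSet_shape_eq τ)
  · intro K H hK hKH τ hτ A hA
    -- The shape determines the order, so conditioning on the order is absorbed by conditioning on
    -- the shape.
    have hsub : ∀ A : Set LTree, {T : LTree | T.order = K} ∩ ({T | T.shape = τ} ∩ A) =
        {T | T.shape = τ} ∩ A := fun A => Set.inter_eq_right.2 fun T hT => by
      have := order_of_shape_eq hT.1
      exact this.trans hτ
    have h2 := hsub Set.univ
    rw [Set.inter_univ] at h2
    rw [subtreeLaw_gw _ hK hKH (measurableSet_shape_eq τ),
      subtreeLaw_gw _ hK hKH ((measurableSet_shape_eq τ).inter hA),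
      cond_apply (measurableSet_order_eq K), cond_apply (measurableSet_order_eq K), hsub, h2,
      cond_apply (measurableSet_shape_eq τ), ENNReal.mul_div_mul_left, div_eq_mul_inv, mul_comm]
    · simp
    · rw [Ne, ENNReal.inv_eq_top, Measure.map_apply measurable_forget (measurableSet_order_eq K)]
      exact gw_order_ne_zero _ hK
  · intro τ
    have h := hcond MeasurableSet.univ (measurableSet_shape_eq τ)
    rw [hU]
    refine h.trans ?_
    have h3 : {T : LTree | T.scale 2 ∈ Set.univ} = Set.univ := Set.eq_univ_of_forall fun T => trivial
    have h4 : {T : LTree | T.scale 2 ∈ {T : LTree | T.shape = τ}} = {T | T.shape = τ} := by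
      ext T
      change (T.scale 2).shape = τ ↔ T.shape = τ
      rw [shape_scale]
    rw [h3, h4, cond_univ]
  · intro τ A hA
    refine (hcond (measurableSet_shape_eq τ) hA).trans ?_
    have h4 : {T : LTree | T.scale 2 ∈ {T : LTree | T.shape = τ}} = {T | T.shape = τ} := by
      ext T
      change (T.scale 2).shape = τ ↔ T.shape = τ
      rw [shape_scale]
    rw [h4]

/-! ### Criticality: the width function -/

namespace HBP

/-- The number of branches of order `j` alive at time `s` in generation `n`. -/
def aliveLevel (j : ℕ) : ℕ → ℝ → PlaneTree (ℕ × ℝ) → ℝ≥0∞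
  | 0, s, t => if t.root.1 = j ∧ 0 ≤ s ∧ s < t.root.2 then 1 else 0
  | _ + 1, _, .leaf _ => 0
  | n + 1, s, .node a l r => aliveLevel j n (s - a.2) l + aliveLevel j n (s - a.2) r

/-- The number of edges alive at time `s` in generation `n`. -/
def edgeLevel : ℕ → ℝ → PlaneTree ℝ → ℝ≥0∞
  | 0, s, t => if 0 ≤ s ∧ s < t.root then 1 else 0
  | _ + 1, _, .leaf _ => 0
  | n + 1, s, .node a l r => edgeLevel n (s - a) l + edgeLevel n (s - a) r

theorem edgeLevel_zero_leaf (s a : ℝ) :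
    edgeLevel 0 s (leaf a) = if 0 ≤ s ∧ s < a then 1 else 0 := rfl

theorem edgeLevel_zero_node (s a : ℝ) (l r : PlaneTree ℝ) :
    edgeLevel 0 s (node a l r) = if 0 ≤ s ∧ s < a then 1 else 0 := rfl

theorem aliveLevel_zero_leaf (j : ℕ) (s : ℝ) (a : ℕ × ℝ) :
    aliveLevel j 0 s (leaf a) = if a.1 = j ∧ 0 ≤ s ∧ s < a.2 then 1 else 0 := rfl

theorem aliveLevel_zero_node (j : ℕ) (s : ℝ) (a : ℕ × ℝ) (l r : PlaneTree (ℕ × ℝ)) :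
    aliveLevel j 0 s (node a l r) = if a.1 = j ∧ 0 ≤ s ∧ s < a.2 then 1 else 0 := rfl

theorem alive_eq_tsum (j : ℕ) (s : ℝ) (t : PlaneTree (ℕ × ℝ)) :
    (alive j s t : ℝ≥0∞) = ∑' n, aliveLevel j n s t := by
  induction t generalizing s with
  | leaf a =>
    rw [tsum_eq_zero_add' ENNReal.summable, aliveLevel_zero_leaf, alive]
    simp only [aliveLevel, tsum_zero, add_zero, Nat.cast_ite, Nat.cast_one, Nat.cast_zero]
  | node a l r ihl ihr =>
    rw [tsum_eq_zero_add' ENNReal.summable, aliveLevel_zero_node, alive]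
    simp only [aliveLevel]
    rw [ENNReal.tsum_add, ← ihl, ← ihr]
    push_cast
    rw [add_assoc]

theorem measurable_aliveLevel (j n : ℕ) :
    Measurable fun p : ℝ × PlaneTree (ℕ × ℝ) => aliveLevel j n p.1 p.2 := by
  have hr : Measurable fun p : ℝ × PlaneTree (ℕ × ℝ) => p.2.root :=
    measurable_root.comp measurable_snd
  induction n with
  | zero =>
    refine Measurable.ite ?_ measurable_const measurable_const
    exact (hr.fst (measurableSet_singleton j)).inter
      ((measurableSet_le measurable_const measurable_fst).inter
        (measurableSet_lt measurable_fst hr.snd))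
  | succ n ih =>
    have e : (fun p : ℝ × PlaneTree (ℕ × ℝ) => aliveLevel j (n + 1) p.1 p.2) = fun p =>
        if p.2.IsLeaf then 0 else aliveLevel j n (p.1 - p.2.root.2) p.2.lft +
          aliveLevel j n (p.1 - p.2.root.2) p.2.rgt := by
      ext ⟨s, t⟩
      cases t <;> rfl
    rw [e]
    refine Measurable.ite (measurable_snd measurableSet_isLeaf) measurable_const (Measurable.add ?_ ?_)
    · exact ih.comp ((measurable_fst.sub hr.snd).prodMk (measurable_lft.comp measurable_snd))
    · exact ih.comp ((measurable_fst.sub hr.snd).prodMk (measurable_rgt.comp measurable_snd))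

theorem measurable_edgeLevel (n : ℕ) :
    Measurable fun p : ℝ × PlaneTree ℝ => edgeLevel n p.1 p.2 := by
  have hr : Measurable fun p : ℝ × PlaneTree ℝ => p.2.root := measurable_root.comp measurable_snd
  induction n with
  | zero =>
    refine Measurable.ite ?_ measurable_const measurable_const
    exact (measurableSet_le measurable_const measurable_fst).inter
      (measurableSet_lt measurable_fst hr)
  | succ n ih =>
    have e : (fun p : ℝ × PlaneTree ℝ => edgeLevel (n + 1) p.1 p.2) = fun p =>
        if p.2.IsLeaf then 0 else edgeLevel n (p.1 - p.2.root) p.2.lft +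
          edgeLevel n (p.1 - p.2.root) p.2.rgt := by
      ext ⟨s, t⟩
      cases t <;> rfl
    rw [e]
    refine Measurable.ite (measurable_snd measurableSet_isLeaf) measurable_const (Measurable.add ?_ ?_)
    · exact ih.comp ((measurable_fst.sub hr).prodMk (measurable_lft.comp measurable_snd))
    · exact ih.comp ((measurable_fst.sub hr).prodMk (measurable_rgt.comp measurable_snd))

/-- Each edge has exactly one order, at least 1, and sorting preserves birth and death times. The
width is thus the mean number of living edges of the Galton–Watson tree. -/
theorem tsum_aliveLevel_sortMark (n : ℕ) (s : ℝ) (t : PlaneTree ℝ) :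
    ∑' j, aliveLevel (j + 1) n s t.sortMark = edgeLevel n s t := by
  induction n generalizing s t with
  | zero =>
    have h1 : t.sortMark.root = (t.order, t.root) := by
      cases t with
      | leaf a => rfl
      | node a l r => simp only [sortMark]; split_ifs <;> rfl
    have h2 := one_le_order t
    simp only [aliveLevel, edgeLevel, h1]
    rw [tsum_eq_single (t.order - 1) fun j hj => if_neg fun h => hj (by omega)]
    rw [Nat.sub_add_cancel h2]
    simp
  | succ n ih =>
    cases t with
    | leaf a => simp [sortMark, aliveLevel, edgeLevel]
    | node a l r =>
      simp only [sortMark]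
      split_ifs
      · simp only [aliveLevel, edgeLevel]
        rw [ENNReal.tsum_add, ih, ih]
      · simp only [aliveLevel, edgeLevel]
        rw [ENNReal.tsum_add, ih, ih, add_comm]

/-- The generation of the edge alive at time `s` on a given line of descent is Poisson. -/
theorem lintegral_edgeLevel {r : ℝ} (hr : 0 < r) (n : ℕ) (s : ℝ) :
    ∫⁻ t, edgeLevel n s t ∂gw (expMeasure r) =
      if 0 ≤ s then ENNReal.ofReal (Real.exp (-(r * s)) * (r * s) ^ n / n.factorial) else 0 := by
  have hν := isProbabilityMeasure_expMeasure hr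
  have hm : ∀ n s, Measurable fun t => edgeLevel n s t := fun n s =>
    (measurable_edgeLevel n).comp measurable_prodMk_left
  induction n generalizing s with
  | zero =>
    rw [lintegral_gw _ (hm 0 s)]
    simp only [edgeLevel_zero_leaf, edgeLevel_zero_node, lintegral_const, measure_univ, mul_one]
    rw [← add_mul, ENNReal.inv_two_add_inv_two, one_mul]
    by_cases hs : 0 ≤ s
    · have : ∀ a : ℝ, (if 0 ≤ s ∧ s < a then 1 else 0 : ℝ≥0∞) =
          (Set.Iic s)ᶜ.indicator 1 a := by
        intro a
        by_cases ha : s < a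
        · rw [if_pos ⟨hs, ha⟩, Set.indicator_of_mem (by simpa using ha)]
          rfl
        · rw [if_neg fun h => ha h.2, Set.indicator_of_notMem (by simpa using ha)]
      simp_rw [this]
      rw [lintegral_indicator_one measurableSet_Iic.compl, prob_compl_eq_one_sub measurableSet_Iic,
        expMeasure_Iic hr, if_pos hs, if_pos hs, ← ENNReal.ofReal_one, ← ENNReal.ofReal_sub]
      · simp
      · rw [sub_nonneg, Real.exp_le_one_iff]
        have := mul_nonneg hr.le hs
        linarith
    · simp [hs]
  | succ n ih =>
    rw [lintegral_gw _ (hm (n + 1) s)]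
    -- The two subtrees have equal means; the factor 2 will cancel the splitting probability 1/2.
    have e1 : ∀ a : ℝ, ∫⁻ x, ∫⁻ y, edgeLevel (n + 1) s (node a x y) ∂gw (expMeasure r)
        ∂gw (expMeasure r) = 2 * ∫⁻ t, edgeLevel n (s - a) t ∂gw (expMeasure r) := by
      intro a
      have e2 : ∀ x, ∫⁻ y, edgeLevel (n + 1) s (node a x y) ∂gw (expMeasure r) =
          edgeLevel n (s - a) x + ∫⁻ y, edgeLevel n (s - a) y ∂gw (expMeasure r) := by
        intro x
        simp only [edgeLevel]
        rw [lintegral_add_left measurable_const, lintegral_const, measure_univ, mul_one]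
      simp_rw [e2]
      rw [lintegral_add_left (hm n _), lintegral_const, measure_univ, mul_one, two_mul]
    have hmE : Measurable fun a : ℝ => ∫⁻ t, edgeLevel n (s - a) t ∂gw (expMeasure r) :=
      (measurable_edgeLevel n).lintegral_prod_right'.comp (measurable_const.sub measurable_id)
    have e3 : ∀ a : ℝ, edgeLevel (n + 1) s (leaf a) = 0 := fun _ => rfl
    simp_rw [e1, e3]
    rw [lintegral_const_mul _ hmE, lintegral_zero, mul_zero, zero_add, ← mul_assoc,
      ENNReal.inv_mul_cancel (by norm_num) (by norm_num), one_mul, lintegral_expMeasure hmE]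
    simp_rw [ih]
    by_cases hs : 0 ≤ s
    · rw [if_pos hs]
      -- Since e^(−ra)e^(−r(s−a)) = e^(−rs) is free of a, the convolution reduces to integrating a
      -- power of s − a.
      have e4 : ∫⁻ a in Set.Ioi 0, ENNReal.ofReal (r * Real.exp (-(r * a))) *
          (if 0 ≤ s - a then ENNReal.ofReal
            (Real.exp (-(r * (s - a))) * (r * (s - a)) ^ n / n.factorial) else 0) =
          ∫⁻ a in Set.Ioc 0 s, ENNReal.ofReal
            (r * Real.exp (-(r * s)) * (r * (s - a)) ^ n / n.factorial) := by
        rw [← lintegral_indicator measurableSet_Ioi, ← lintegral_indicator measurableSet_Ioc]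
        refine lintegral_congr fun a => ?_
        by_cases ha : 0 < a
        · rw [Set.indicator_of_mem (by exact ha)]
          by_cases has : a ≤ s
          · rw [Set.indicator_of_mem (by exact ⟨ha, has⟩), if_pos (by linarith),
              ← ENNReal.ofReal_mul (by positivity)]
            congr 1
            have : Real.exp (-(r * s)) = Real.exp (-(r * a)) * Real.exp (-(r * (s - a))) := by
              rw [← Real.exp_add]; ring_nf
            rw [this]
            ring
          · rw [Set.indicator_of_notMem (fun h => has h.2), if_neg (by linarith), mul_zero]
        · rw [Set.indicator_of_notMem (by exact ha), Set.indicator_of_notMem (fun h => ha h.1)]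
      rw [e4, lintegral_Ioc_of_hasDerivAt
        (F := fun a => -(Real.exp (-(r * s)) * (r * (s - a)) ^ (n + 1) / (n + 1).factorial)) hs
        ?_ (by fun_prop) ?_]
      · congr 1
        simp
      · intro a
        have d : HasDerivAt (fun a => r * (s - a)) (r * (-1)) a :=
          ((hasDerivAt_id a).const_sub s).const_mul r
        refine ((((d.pow (n + 1)).const_mul (Real.exp (-(r * s)))).div_const _).neg).congr_deriv ?_
        rw [Nat.factorial_succ]
        push_cast
        have : (n.factorial : ℝ) ≠ 0 := by positivity
        field_simp
      · intro a ha
        have : 0 ≤ s - a := by linarith [ha.2]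
        positivity
    · rw [if_neg hs]
      have e4 : ∀ a ∈ Set.Ioi (0 : ℝ), ENNReal.ofReal (r * Real.exp (-(r * a))) *
          (if 0 ≤ s - a then ENNReal.ofReal
            (Real.exp (-(r * (s - a))) * (r * (s - a)) ^ n / n.factorial) else 0) = 0 := by
        intro a ha
        have ha : 0 < a := ha
        rw [if_neg (by linarith), mul_zero]
      rw [setLIntegral_congr_fun measurableSet_Ioi e4, lintegral_zero]

theorem IsCriticalTokunaga.isCritical {S : HBP} {γ : ℝ} (h : S.IsCriticalTokunaga γ) :
    S.IsCritical := by
  intro s hs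
  have hr : 0 < 2 * γ := by linarith [h.pos]
  have hν := isProbabilityMeasure_expMeasure hr
  have hm : ∀ j n, Measurable fun t => aliveLevel j n s t := fun j n =>
    (measurable_aliveLevel j n).comp measurable_prodMk_left
  have hm' : ∀ j n, Measurable fun t : PlaneTree ℝ => aliveLevel j n s t.sortMark := fun j n =>
    (hm j n).comp measurable_sortMark
  have h1 : ∀ j, S.average j s = ∫⁻ t, ∑' n, aliveLevel j n s t.sortMark
      ∂gw (expMeasure (2 * γ)) := by
    intro j
    rw [average, h.processLaw_eq]
    simp_rw [alive_eq_tsum]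
    rw [lintegral_map (Measurable.tsum fun n => hm j n) measurable_sortMark]
  rw [width]
  simp_rw [h1]
  rw [← lintegral_tsum fun j => (Measurable.tsum fun n => hm' _ n).aemeasurable]
  have h3 : ∀ t : PlaneTree ℝ, ∑' j, ∑' n, aliveLevel (j + 1) n s t.sortMark =
      ∑' n, edgeLevel n s t := fun t => by
    rw [ENNReal.tsum_comm]
    exact tsum_congr fun n => tsum_aliveLevel_sortMark n s t
  have hE : ∀ n, Measurable fun t => edgeLevel n s t := fun n =>
    (measurable_edgeLevel n).comp measurable_prodMk_left
  simp_rw [h3]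
  rw [lintegral_tsum fun n => (hE n).aemeasurable]
  simp_rw [lintegral_edgeLevel hr, if_pos hs]
  have h2 := ((NormedSpace.expSeries_div_hasSum_exp (2 * γ * s)).mul_left (Real.exp (-(2 * γ * s))))
  rw [← Real.exp_eq_exp_ℝ, ← Real.exp_add, neg_add_cancel, Real.exp_zero] at h2
  simp_rw [← mul_div_assoc] at h2
  rw [← ENNReal.ofReal_tsum_of_nonneg _ h2.summable, h2.tsum_eq, ENNReal.ofReal_one]
  intro n
  have := mul_nonneg hr.le hs
  positivity

end HBP

namespace HBP

variable {S : HBP} {γ : ℝ}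

/-! ### Time invariance -/

section TimeInvariance

/-- On the k-th superdiagonal the entries of 𝔾 are at most 3·2^k (with T_1 + 2 = 3 for k = 1), and
λ_{i+k+1} = 2γ·2^(−i−k). The powers of 2^k cancel, and the remaining bound is summable over the
rows. -/
theorem IsCriticalTokunaga.abs_G_mul_lam_le (h : S.IsCriticalTokunaga γ) (i j : ℕ) :
    |S.G i j * S.lam (j + 1)| ≤ 6 * γ * (1 / 2) ^ i := by
  have hγ := h.pos
  have hlam : 0 < S.lam (j + 1) := S.lam_pos _ (by omega)
  have key : ∀ k : ℕ, j = i + k → |S.G i j| ≤ 3 * 2 ^ k →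
      |S.G i j * S.lam (j + 1)| ≤ 6 * γ * (1 / 2) ^ i := by
    rintro k rfl hk
    rw [abs_mul, abs_of_pos hlam]
    refine (mul_le_mul_of_nonneg_right hk hlam.le).trans_eq ?_
    have h2 : (2 : ℝ) ^ k * (1 / 2) ^ k = 1 := by rw [← mul_pow]; norm_num
    rw [h.lam_succ, pow_add]
    linear_combination 6 * γ * (1 / 2) ^ i * h2
  rcases lt_trichotomy j i with hij | hij | hij
  · rw [G, if_neg (by omega), if_neg (by omega), if_neg (by omega), zero_mul, abs_zero]
    positivity
  · refine key 0 (by omega) ?_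
    rw [G, if_pos hij]
    norm_num
  · obtain ⟨k, rfl⟩ : ∃ k, j = i + k + 1 := ⟨j - i - 1, by omega⟩
    refine key (k + 1) (by omega) ?_
    rw [G, if_neg (by omega)]
    split_ifs with h1
    · have : k = 0 := by omega
      subst this
      rw [h.T_eq 1 le_rfl]
      norm_num
    · rw [h.T_eq _ (by omega), show i + k + 1 - i - 1 = k by omega,
        abs_of_pos (by positivity), pow_succ]
      have : (0 : ℝ) < 2 ^ k := by positivity
      linarith

theorem G_of_lt {i j : ℕ} (hij : j < i) : S.G i j = 0 := by
  rw [G, if_neg (by omega), if_neg (by omega), if_neg (by omega)]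

/-- The columns of the matrix `𝔾Λ`. -/
def column (S : HBP) (j : ℕ) : SeqL1 :=
  ∑ i ∈ Finset.range (j + 1), lp.single 1 i (S.G i j * S.lam (j + 1))

theorem column_apply (i j : ℕ) : S.column j i = S.G i j * S.lam (j + 1) := by
  rw [column, lp.coeFn_sum, Finset.sum_apply]
  by_cases hij : i ≤ j
  · rw [Finset.sum_eq_single i]
    · exact lp.single_apply_self _ _ _
    · intro k _ hk
      exact lp.single_apply_ne _ _ _ (Ne.symm hk)
    · intro hi
      exact absurd (Finset.mem_range.2 (by omega)) hi
  · rw [G_of_lt (by omega), zero_mul]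
    refine Finset.sum_eq_zero fun k hk => ?_
    have := Finset.mem_range.1 hk
    exact lp.single_apply_ne _ _ _ (by omega)

/-- A matrix with uniformly bounded ℓ¹ norms of its columns acts boundedly on ℓ¹; this is where the
boundedness of 𝔾Λ comes from. -/
theorem IsCriticalTokunaga.norm_column_le (h : S.IsCriticalTokunaga γ) (j : ℕ) :
    ‖S.column j‖ ≤ 12 * γ := by
  refine (norm_sum_le _ _).trans ?_
  refine (Finset.sum_le_sum fun i _ => ?_).trans (?_ :
    ∑ i ∈ Finset.range (j + 1), 6 * γ * (1 / 2 : ℝ) ^ i ≤ _)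
  · rw [lp.norm_single (by norm_num)]
    exact h.abs_G_mul_lam_le i j
  · rw [← Finset.mul_sum]
    have := sum_geometric_two_le (j + 1)
    have hγ := h.pos
    nlinarith

theorem hasSum_abs (x : SeqL1) : HasSum (fun j => |x j|) ‖x‖ := by
  have := lp.hasSum_norm (by norm_num) x
  simpa using this

theorem IsCriticalTokunaga.norm_smul_column_le (h : S.IsCriticalTokunaga γ) (x : SeqL1) (j : ℕ) :
    ‖x j • S.column j‖ ≤ |x j| * (12 * γ) := by
  rw [norm_smul]
  exact mul_le_mul_of_nonneg_left (h.norm_column_le j) (abs_nonneg _)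

theorem IsCriticalTokunaga.summable_smul_column (h : S.IsCriticalTokunaga γ) (x : SeqL1) :
    Summable fun j => x j • S.column j :=
  Summable.of_norm_bounded ((hasSum_abs x).mul_right (12 * γ)).summable
    (h.norm_smul_column_le x)

/-- The bounded operator on `ℓ¹` defined by the matrix `𝔾Λ`. -/
def IsCriticalTokunaga.generator (h : S.IsCriticalTokunaga γ) : SeqL1 →L[ℝ] SeqL1 :=
  LinearMap.mkContinuous
    { toFun := fun x => ∑' j, x j • S.column j
      map_add' := fun x y => by
        rw [← (h.summable_smul_column x).tsum_add (h.summable_smul_column y)]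
        exact tsum_congr fun j => add_smul _ _ _
      map_smul' := fun c x => by
        rw [RingHom.id_apply, ← (h.summable_smul_column x).tsum_const_smul]
        exact tsum_congr fun j => mul_smul _ _ _ }
    (12 * γ) fun x => by
      rw [mul_comm]
      exact tsum_of_norm_bounded ((hasSum_abs x).mul_right (12 * γ)) (h.norm_smul_column_le x)

theorem IsCriticalTokunaga.hasSum_generator (h : S.IsCriticalTokunaga γ) (x : SeqL1) (i : ℕ) :
    HasSum (fun j => S.G i j * S.lam (j + 1) * x j) (h.generator x i) := by
  have := (h.summable_smul_column x).hasSum.mapL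
    (lp.evalCLM ℝ (fun _ : ℕ => ℝ) 1 i)
  have e : ∀ j, S.G i j * S.lam (j + 1) * x j =
      lp.evalCLM ℝ (fun _ : ℕ => ℝ) 1 i (x j • S.column j) := fun j => by
    change _ = x j * S.column j i
    rw [column_apply, mul_comm]
  simp_rw [e]
  exact this

theorem IsCriticalTokunaga.hasSum_G_initial (h : S.IsCriticalTokunaga γ) (i : ℕ) :
    HasSum (fun j => S.G i j * S.lam (j + 1) * S.initial j) 0 := by
  have hp : ∀ j, S.lam (j + 1) * S.initial j = γ * (1 / 4) ^ j := by
    intro j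
    change S.lam (j + 1) * S.p (j + 1) = _
    rw [h.lam_succ, h.p_of_pos (by omega), pow_succ, show (1 / 4 : ℝ) = 1 / 2 * (1 / 2) by norm_num,
      mul_pow]
    ring
  simp_rw [mul_assoc, hp]
  -- The diagonal and the first superdiagonal do not follow the pattern of the other entries. They
  -- contribute −γ4^(−i) + 3γ4^(−i−1) = −γ4^(−i)/4, which the geometric tail compensates.
  rw [← hasSum_nat_add_iff' (i + 2)]
  have e : ∑ j ∈ Finset.range (i + 2), S.G i j * (γ * (1 / 4) ^ j) = -(γ * (1 / 4) ^ i / 4) := by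
    rw [Finset.sum_range_succ, Finset.sum_range_succ, Finset.sum_eq_zero fun j hj => by
      rw [G_of_lt (Finset.mem_range.1 hj), zero_mul], G, if_pos rfl, G, if_neg (by omega),
      if_pos rfl, h.T_eq 1 le_rfl]
    norm_num
    ring
  rw [e, zero_sub, neg_neg]
  have e2 : ∀ n, S.G i (n + (i + 2)) * (γ * (1 / 4) ^ (n + (i + 2))) =
      γ * (1 / 4) ^ i / 8 * (1 / 2) ^ n := by
    intro n
    rw [G, if_neg (by omega), if_neg (by omega), if_pos (by omega), h.T_eq _ (by omega),
      show n + (i + 2) - i - 1 = n + 1 by omega, pow_add (1 / 4 : ℝ) n, pow_add (1 / 4 : ℝ) i,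
      show (1 / 4 : ℝ) ^ n = (1 / 2) ^ n * (1 / 2) ^ n by rw [← mul_pow]; norm_num, pow_succ]
    have h2 : (2 : ℝ) ^ n * (1 / 2) ^ n = 1 := by rw [← mul_pow]; norm_num
    linear_combination γ * (1 / 4) ^ i * (1 / 2) ^ n / 8 * h2
  simp_rw [e2]
  have h3 := hasSum_geometric_two.mul_left (γ * (1 / 4) ^ i / 8)
  rwa [show γ * (1 / 4) ^ i / 8 * 2 = γ * (1 / 4) ^ i / 4 by ring] at h3

/-- Every term of the exponential series except the zeroth applies M to x first. -/
theorem exp_smul_apply_of_apply_eq_zero {M : SeqL1 →L[ℝ] SeqL1} {x : SeqL1} (hx : M x = 0)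
    (s : ℝ) : (NormedSpace.exp (s • M)) x = x := by
  have h1 := (NormedSpace.exp_series_hasSum_exp' (𝕂 := ℝ) (s • M)).mapL
    (ContinuousLinearMap.apply ℝ SeqL1 x)
  refine h1.unique ?_
  convert hasSum_single 0 fun n hn => ?_ using 1
  · simp
  · obtain ⟨m, rfl⟩ := Nat.exists_eq_succ_of_ne_zero hn
    change ((m + 1).factorial : ℝ)⁻¹ • ((s • M) ^ (m + 1)) x = 0
    have h2 : (s • M) x = 0 := by simp [hx]
    rw [pow_succ, mul_apply_eq_comp, h2, map_zero, smul_zero]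

theorem IsCriticalTokunaga.isTimeInvariant (h : S.IsCriticalTokunaga γ) : S.IsTimeInvariant := by
  refine ⟨h.generator, h.hasSum_generator, fun s _ => exp_smul_apply_of_apply_eq_zero ?_ s⟩
  ext i
  exact (h.hasSum_generator S.initial i).unique (h.hasSum_G_initial i)

end TimeInvariance

/-! ### The growth rate and the Horton exponent -/

section Horton

theorem IsCriticalTokunaga.L_eq (h : S.IsCriticalTokunaga γ) : S.L = 2 := by
  have h1 : Filter.Tendsto (fun k : ℕ => ENNReal.ofReal ((2 : ℝ) ^ (1 - 1 / (k : ℝ))))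
      Filter.atTop (nhds 2) := by
    have h2 : Filter.Tendsto (fun k : ℕ => (1 : ℝ) - 1 / (k : ℝ)) Filter.atTop (nhds (1 - 0)) :=
      tendsto_const_nhds.sub tendsto_one_div_atTop_nhds_zero_nat
    have h3 := ENNReal.tendsto_ofReal
      (((Real.continuous_const_rpow (two_ne_zero : (2 : ℝ) ≠ 0)).tendsto _).comp h2)
    simpa using h3
  refine (h1.congr' ?_).limsup_eq
  -- For k ≥ 1 the term is 2^(1 − 1/k); the value at k = 0 is unspecified.
  filter_upwards [Filter.eventually_ge_atTop 1] with k hk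
  have hk' : (0 : ℝ) < k := by exact_mod_cast hk
  rw [h.T_eq k hk, ENNReal.ofReal_rpow_of_nonneg (by positivity) (by positivity),
    ← Real.rpow_natCast, ← Real.rpow_mul (by norm_num), Nat.cast_sub hk]
  congr 2
  field_simp
  simp

theorem IsCriticalTokunaga.hasSum_pow_mul_T (h : S.IsCriticalTokunaga γ) {w : ℝ} (h0 : 0 < w)
    (h1 : w < 1 / 2) : HasSum (fun n : ℕ => w ^ (n + 1) * S.T (n + 1)) (w * (1 - 2 * w)⁻¹) := by
  have h2 := (hasSum_geometric_of_lt_one (by positivity : 0 ≤ 2 * w) (by linarith)).mul_left w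
  refine h2.congr_fun ?_
  intro n
  rw [h.T_eq _ (by omega), Nat.add_sub_cancel, mul_pow]
  ring

theorem IsCriticalTokunaga.isHortonExponent (h : S.IsCriticalTokunaga γ) :
    S.IsHortonExponent 4 := by
  have hlt : ∀ w : ℝ, ENNReal.ofReal w < 1 / S.L ↔ w < 1 / 2 := by
    intro w
    rw [h.L_eq, one_div, ← ofReal_half, ENNReal.ofReal_lt_ofReal_iff (by norm_num)]
  refine ⟨1 / 4, ⟨by norm_num, by norm_num, (hlt _).2 (by norm_num), ?_⟩, ?_, by norm_num⟩
  · have := h.hasSum_pow_mul_T (w := 1 / 4) (by norm_num) (by norm_num)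
    norm_num at this ⊢
    exact this
  · rintro v ⟨hv0, -, hv, hs⟩
    have hv := (hlt v).1 hv
    have e := (h.hasSum_pow_mul_T hv0 hv).unique hs
    have hne : 1 - 2 * v ≠ 0 := by linarith
    rw [← div_eq_mul_inv, div_eq_iff hne] at e
    -- The series sums to v/(1 − 2v), so the equation reads (1 − 2v)² = v; the root v = 1 violates v
    -- < 1/2.
    have : (4 * v - 1) * (v - 1) = 0 := by linear_combination -e
    rcases mul_eq_zero.1 this with h1 | h1 <;> linarith

end Horton

end HBP

end RandomTree

end

theorem theorem8 (γ : ℝ) (hγ : 0 < γ) (S : RandomTree.HBP)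
    (hlam : ∀ j : ℕ, 1 ≤ j → S.lam j = γ * (2 : ℝ) ^ (2 - (j : ℤ)))
    (hp : ∀ K : ℕ, 1 ≤ K → S.p K = (2 : ℝ) ^ (-(K : ℤ)))
    (hT : ∀ k : ℕ, 1 ≤ k → S.T k = (2 : ℝ) ^ (k - 1)) :
    S.treeLaw = (RandomTree.expGW 0 γ).map RandomTree.PlaneTree.forget ∧
    RandomTree.IsSelfSimilar S.treeLaw 2 ∧
    S.IsCritical ∧
    S.IsTimeInvariant ∧
    S.IsHortonExponent 4 ∧
    S.L = 2 := by
  have h : S.IsCriticalTokunaga γ := ⟨hγ, hlam, hp, hT⟩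
  have ht : S.treeLaw = (RandomTree.expGW 0 γ).map RandomTree.PlaneTree.forget := by
    rw [h.treeLaw_eq, RandomTree.expGW_zero hγ]
  refine ⟨ht, ?_, h.isCritical, h.isTimeInvariant, h.isHortonExponent, h.L_eq⟩
  rw [h.treeLaw_eq]
  exact RandomTree.isSelfSimilar_gw hγ
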